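/- Let $\Bbbk$ be an arbitrary field, $V$ a finite-dimensional $\Bbbk$-vector space and $\Omega\subseteq V\otimes V$ a subspace. Write $Q(V,\Omega)=T(V)/(\Omega)$ for the quotient of the tensor algebra by the two-sided ideal generated by $\Omega$, with the grading induced by tensor degree. Let $A=\bigoplus_{n\ge 0}A_n$ be a quadratic algebra with this presentation, i.e. a graded $\Bbbk$-algebra isomorphic, as a graded algebra, to $Q(V,\Omega)$, and let $A^!=Q(V^*,\Omega^\perp)$ be its quadratic dual, where $\Omega^\perp\subseteq V^*\otimes V^*=(V\otimes V)^*$ is the annihilator of $\Omega$. A graded algebra $B$ with $B_0=\Bbbk$ is called Koszul if the trivial module $\Bbbk=B/\bigoplus_{n>0}B_n$ has a resolution $\cdots\to P(2)\to P(1)\to P(0)\to\Bbbk\to 0$ by graded free right $B$-modules and degree-preserving maps such that, for each $n$, the component $P(n)_n$ is finite-dimensional and generates $P(n)$. The cohomological dimension of $B$ is $\mathrm{cd}(B)=\sup\{n : \mathrm{Ext}^n_B(\Bbbk,\Bbbk)\neq 0\}$. Suppose that $A_1=U\oplus W$ as vector spaces, with (i) $U\cdot W:=\mathrm{Span}\{uw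 : u\in U,\ w\in W\}=A_2$, and (ii) $U\cdot U:=\mathrm{Span}\{uu' : u,u'\in U\}=0$. Then $A$ and $A^!$ are Koszul, $A_3=0$, and $\mathrm{cd}(A^!)\le 2$; if moreover $A_2\neq 0$, then $\mathrm{cd}(A^!)=2$. -/

import Mathlib

open scoped TensorProduct DirectSum

universe u v w

/-! ### Quadratic algebras `Q(V, Ω) = T(V) / (Ω)` and their quadratic duals -/

namespace QuadAlg

section Quadratic

variable {k : Type u} [Field k] {V : Type w} [AddCommGroup V] [Module k V]

/-- The inclusion `V ⊗ V → T(V)`, `v ⊗ w ↦ v w`, of the degree two part of the tensor algebra. -/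
noncomputable def tensorSq (k : Type u) [Field k] (V : Type w) [AddCommGroup V] [Module k V] :
    V ⊗[k] V →ₗ[k] TensorAlgebra k V :=
  LinearMap.mul' k (TensorAlgebra k V) ∘ₗ
    TensorProduct.map (TensorAlgebra.ι k) (TensorAlgebra.ι k)

/-- The relations `x = 0` in `T(V)`, for `x ∈ Ω ⊆ V ⊗ V`. -/
inductive Rel (Ω : Submodule k (V ⊗[k] V)) : TensorAlgebra k V → TensorAlgebra k V → Prop
  | of (x : V ⊗[k] V) (hx : x ∈ Ω) : Rel Ω (tensorSq k V x) 0

/-- The algebra `Q(V, Ω) = T(V) / (Ω)`: the quotient of the tensor algebra by the two-sided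
ideal generated by `Ω ⊆ V ⊗ V`. -/
abbrev Quad (Ω : Submodule k (V ⊗[k] V)) : Type (max u w) := RingQuot (Rel Ω)

/-- The canonical map `V → Q(V, Ω)`. -/
noncomputable def Quad.ι (Ω : Submodule k (V ⊗[k] V)) : V →ₗ[k] Quad Ω :=
  (RingQuot.mkAlgHom k (Rel Ω)).toLinearMap ∘ₗ TensorAlgebra.ι k

/-- The grading of `Q(V, Ω)` induced by the tensor grading: the degree `n` component is the
span of the products of `n` elements of `V`. -/
noncomputable def Quad.grading (Ω : Submodule k (V ⊗[k] V)) : ℕ → Submodule k (Quad Ω) :=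
  fun n => LinearMap.range (Quad.ι Ω) ^ n

instance Quad.gradedMonoid (Ω : Submodule k (V ⊗[k] V)) :
    SetLike.GradedMonoid (Quad.grading Ω) :=
  Submodule.nat_power_gradedMonoid (LinearMap.range (Quad.ι Ω))

theorem Quad.ι_mem (Ω : Submodule k (V ⊗[k] V)) (x : V) : Quad.ι Ω x ∈ Quad.grading Ω 1 := by
  simp [Quad.grading]

/-- Auxiliary to the grading of `Q(V, Ω)`: the map `V → ⨁ n, Q(V, Ω)_n`. -/
noncomputable def Quad.gι (Ω : Submodule k (V ⊗[k] V)) : V →ₗ[k] ⨁ i, Quad.grading Ω i :=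
  DirectSum.lof k ℕ (fun i => Quad.grading Ω i) 1 ∘ₗ
    (Quad.ι Ω).codRestrict _ (Quad.ι_mem Ω)

theorem Quad.lift_tensorSq (Ω : Submodule k (V ⊗[k] V)) (x : V ⊗[k] V) :
    ∃ y : Quad.grading Ω 2, (y : Quad Ω) = RingQuot.mkAlgHom k (Rel Ω) (tensorSq k V x) ∧
    TensorAlgebra.lift k (Quad.gι Ω) (tensorSq k V x) =
      DirectSum.of (fun i => Quad.grading Ω i) 2 y := by
  induction x with
  | zero => exact ⟨0, by simp, by simp⟩
  | add x y hx hy =>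
    obtain ⟨a, ha, ex⟩ := hx
    obtain ⟨b, hb, ey⟩ := hy
    exact ⟨a + b, by simp [ha, hb], by rw [map_add, map_add, ex, ey, ← map_add]⟩
  | tmul x y =>
    refine ⟨⟨Quad.ι Ω x * Quad.ι Ω y,
      SetLike.mul_mem_graded (Quad.ι_mem Ω x) (Quad.ι_mem Ω y)⟩, by simp [tensorSq, Quad.ι], ?_⟩
    simp only [tensorSq, LinearMap.comp_apply, TensorProduct.map_tmul, LinearMap.mul'_apply,
      map_mul, TensorAlgebra.lift_ι_apply, Quad.gι, DirectSum.lof_eq_of, DirectSum.of_mul_of]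
    exact DirectSum.of_eq_of_gradedMonoid_eq (Sigma.subtype_ext rfl rfl)

/-- Auxiliary to the grading of `Q(V, Ω)`: the algebra map `Q(V, Ω) → ⨁ n, Q(V, Ω)_n`. -/
noncomputable def Quad.decomp (Ω : Submodule k (V ⊗[k] V)) :
    Quad Ω →ₐ[k] ⨁ i, Quad.grading Ω i :=
  RingQuot.liftAlgHom k ⟨TensorAlgebra.lift k (Quad.gι Ω), by
    rintro _ _ ⟨x, hx⟩
    obtain ⟨y, hy, e⟩ := Quad.lift_tensorSq Ω x
    rw [RingQuot.mkAlgHom_rel k (Rel.of x hx), map_zero] at hy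
    rw [e, map_zero, show y = 0 from Subtype.ext hy, map_zero]⟩

theorem Quad.decomp_ι (Ω : Submodule k (V ⊗[k] V)) (x : V) :
    Quad.decomp Ω (Quad.ι Ω x) =
      DirectSum.of (fun i => Quad.grading Ω i) 1 ⟨Quad.ι Ω x, Quad.ι_mem Ω x⟩ := by
  simp only [Quad.decomp, Quad.ι, LinearMap.comp_apply, AlgHom.toLinearMap_apply,
    RingQuot.liftAlgHom_mkAlgHom_apply, TensorAlgebra.lift_ι_apply]
  rfl

/-- `Q(V, Ω)` is a graded algebra. -/
noncomputable instance Quad.gradedAlgebra (Ω : Submodule k (V ⊗[k] V)) :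
    GradedAlgebra (Quad.grading Ω) :=
  GradedAlgebra.ofAlgHom _ (Quad.decomp Ω)
    (by
      apply RingQuot.ringQuot_ext'
      ext x
      have := Quad.decomp_ι Ω x
      simp only [Quad.ι, LinearMap.comp_apply, AlgHom.toLinearMap_apply] at this
      simp only [LinearMap.comp_apply, AlgHom.toLinearMap_apply, AlgHom.comp_apply,
        AlgHom.id_apply]
      rw [this, DirectSum.coeAlgHom_of])
    (fun i x => by
      obtain ⟨x, hx⟩ := x
      dsimp only [Subtype.coe_mk]
      unfold Quad.grading at hx
      induction hx using Submodule.pow_induction_on_left' with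
      | algebraMap r => rw [AlgHom.commutes, DirectSum.algebraMap_apply]; rfl
      | add x y i hx hy ihx ihy => rw [map_add, ihx, ihy, ← map_add]; rfl
      | mem_mul m hm i x hx ih =>
        obtain ⟨y, rfl⟩ := hm
        rw [map_mul, ih, Quad.decomp_ι, DirectSum.of_mul_of]
        exact DirectSum.of_eq_of_gradedMonoid_eq (Sigma.subtype_ext (add_comm _ _) rfl))

/-- The orthogonal space `Ω^⊥ ⊆ V* ⊗ V*` of `Ω ⊆ V ⊗ V`, where `α ⊗ β` is the functional
`x ⊗ y ↦ α x * β y` on `V ⊗ V`. -/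
noncomputable def orth (Ω : Submodule k (V ⊗[k] V)) :
    Submodule k (Module.Dual k V ⊗[k] Module.Dual k V) :=
  Ω.dualAnnihilator.comap (TensorProduct.dualDistrib k V V)

end Quadratic

/-! ### Graded right modules, Koszul algebras, cohomological dimension

Right `A`-modules are modules over `Aᵐᵒᵖ`: the product `p · a` is `MulOpposite.op a • p`. -/

section Koszul

variable {k : Type u} [Field k] {A : Type v} [Ring A] [Algebra k A]

/-- A (non-negatively) graded right module over a graded algebra. -/
structure GradedRightModule (𝒜 : ℕ → Submodule k A) where
  carrier : Type v
  [addCommGroup : AddCommGroup carrier]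
  [moduleBase : Module k carrier]
  [module : Module Aᵐᵒᵖ carrier]
  [isScalarTower : IsScalarTower k Aᵐᵒᵖ carrier]
  /-- the homogeneous components -/
  deg : ℕ → Submodule k carrier
  isInternal : DirectSum.IsInternal deg
  smul_mem : ∀ (i j : ℕ) (a : A) (p : carrier), a ∈ 𝒜 i → p ∈ deg j →
    MulOpposite.op a • p ∈ deg (j + i)

attribute [instance] GradedRightModule.addCommGroup GradedRightModule.moduleBase
  GradedRightModule.module GradedRightModule.isScalarTower

/-- A graded right module is graded free if it has a basis of homogeneous elements. -/
def GradedRightModule.IsFree {𝒜 : ℕ → Submodule k A} (P : GradedRightModule 𝒜) : Prop :=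
  ∃ s : Set P.carrier, (∀ x ∈ s, ∃ n, x ∈ P.deg n) ∧
    LinearIndependent Aᵐᵒᵖ (Subtype.val : s → P.carrier) ∧ Submodule.span Aᵐᵒᵖ s = ⊤

/-- The right ideal `A_+` generated by the homogeneous elements of positive degree. -/
def augIdeal (𝒜 : ℕ → Submodule k A) : Submodule Aᵐᵒᵖ A :=
  Submodule.span Aᵐᵒᵖ {a | ∃ i, 0 < i ∧ a ∈ 𝒜 i}

/-- The trivial right module `A / A_+`. For a connected algebra (`A_0 = k`) this is the
one-dimensional module `k`. -/
abbrev Triv (𝒜 : ℕ → Submodule k A) : Type v := A ⧸ augIdeal 𝒜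

/-- A linear free resolution `⋯ → P(2) → P(1) → P(0) → k → 0` of the trivial module: graded free
right modules, with differentials preserving degrees (and `k` placed in degree `0`), such that
`P(n)_n` is finite-dimensional and generates `P(n)`. -/
structure LinearFreeResolution (𝒜 : ℕ → Submodule k A) where
  P : ℕ → GradedRightModule 𝒜
  isFree : ∀ n, (P n).IsFree
  finite : ∀ n, FiniteDimensional k ((P n).deg n)
  generated : ∀ n, Submodule.span Aᵐᵒᵖ ((P n).deg n : Set (P n).carrier) = ⊤
  d : ∀ n, (P (n + 1)).carrier →ₗ[Aᵐᵒᵖ] (P n).carrier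
  d_mem : ∀ n m p, p ∈ (P (n + 1)).deg m → d n p ∈ (P n).deg m
  ε : (P 0).carrier →ₗ[Aᵐᵒᵖ] Triv 𝒜
  ε_eq_zero : ∀ m p, 0 < m → p ∈ (P 0).deg m → ε p = 0
  exact_d : ∀ n, Function.Exact (d (n + 1)) (d n)
  exact_ε : Function.Exact (d 0) ε
  surjective_ε : Function.Surjective ε

/-- A graded algebra is Koszul if its trivial module has a linear free resolution. -/
def IsKoszul (𝒜 : ℕ → Submodule k A) : Prop := Nonempty (LinearFreeResolution 𝒜)

/-- The cohomological dimension of a graded algebra: the largest `n` (possibly `∞`) such that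
`Ext^n_A(k, k) ≠ 0`, where `Ext` is taken in the category of right `A`-modules. -/
noncomputable def cd (𝒜 : ℕ → Submodule k A) : ℕ∞ :=
  ⨆ n ∈ {n : ℕ | Nontrivial (CategoryTheory.Abelian.Ext
    (ModuleCat.of Aᵐᵒᵖ (Triv 𝒜)) (ModuleCat.of Aᵐᵒᵖ (Triv 𝒜)) n)}, (n : ℕ∞)

end Koszul

end QuadAlg

/-!
The algebra `A = k ⊕ A₁ ⊕ A₂` has no component of degree three, since
`A₃ = U W A₁ ⊆ U A₂ = U U W = 0`. Write `B = A^! = Q(V^*, Ω^⊥)`.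

*The quadratic dual.* For every quadratic algebra the complex `Ω ⊗ B → V ⊗ B → B` of free right
modules is exact (`exact_relMat_genMat`): the space `k ⊕ (V ⊗ B) / (Ω ⊗ B)` carries a left
`B`-module structure, with `v ∈ V` acting through `v · (c, [x]) = (0, [v ⊗ (c + x)])`, where `x` is
evaluated in `B`, and acting on `(1, 0)` inverts the evaluation map to `B`. Choose a basis of
`V = A₁` adapted to `U ⊕ W`. The condition `UU = 0` says that the elements of `Ω^⊥` have no
component in `U^* ⊗ U^*`, and `UW = A₂` says that they are determined by their component in
`U^* ⊗ W^*`. An induction on the degree then gives that `W^* ⊗ B → B` is injective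
(`eq_zero_of_sum_ι_mul_homogeneous`): an element of its kernel comes from an element of
`Ω^⊥ ⊗ B` whose image in `U^* ⊗ B` vanishes, `Ω^⊥ ⊗ B` embeds into `U^* ⊗ W^* ⊗ B`, and
`U^* ⊗ W^* ⊗ B → U^* ⊗ B` is injective in lower degrees. The same argument shows that
`Ω^⊥ ⊗ B → V^* ⊗ B` is injective (`relMat_injective`), so that `0 → Ω^⊥ ⊗ B → V^* ⊗ B → B → k → 0` is a linear free resolution. Its
length bounds the cohomological dimension, and its differentials vanish after applying `Hom(-, k)`,
so `Ext²(k, k) ≠ 0` unless `Ω^⊥ = 0`.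

*The algebra itself.* The linear resolution over `A` is built directly, step by step, without
passing through the dual. A syzygy module is generated by a space `F` of column vectors with entries
in `A₁`. The property which is propagated is the existence of a flag `0 = F₀ ⊆ ⋯ ⊆ Fₘ = F` with
`Fᵢ₊₁ U ⊆ Fᵢ W` (`LinFilt`). For the augmentation ideal the flag is `0 ⊆ U ⊆ A₁`. Given such a flag
for `F`, the linear syzygies of `F` generate all of them, and they have a flag of the same kind,
whose members are the linear syzygies in `Fᵢ ⊗ A₁` and in `Fᵢ ⊗ A₁ + Fᵢ₊₁ ⊗ U`
(`LinFilt.syzygies`).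
-/

/-! ### Projective resolutions of length two and `Ext²` -/

namespace QuadAlg

section Ext

open CategoryTheory CategoryTheory.Abelian

variable {R : Type v} [Ring R] {M P₀ P₁ P₂ : Type v} [AddCommGroup M] [AddCommGroup P₀]
  [AddCommGroup P₁] [AddCommGroup P₂] [Module R M] [Module R P₀] [Module R P₁] [Module R P₂]

theorem shortExact_of_linearMap {X Y Z : Type v} [AddCommGroup X] [AddCommGroup Y]
    [AddCommGroup Z] [Module R X] [Module R Y] [Module R Z] (f : X →ₗ[R] Y) (g : Y →ₗ[R] Z)
    (hf : Function.Injective f) (hg : Function.Surjective g) (hfg : Function.Exact f g) :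
    (ShortComplex.mk (ModuleCat.ofHom f) (ModuleCat.ofHom g)
      (by ext x; exact hfg.apply_apply_eq_zero x)).ShortExact := by
  have hm : Mono (ModuleCat.ofHom f) := (ModuleCat.mono_iff_injective _).2 hf
  have he : Epi (ModuleCat.ofHom g) := (ModuleCat.epi_iff_surjective _).2 hg
  refine { exact := ?_, mono_f := hm, epi_g := he }
  rw [ShortComplex.ShortExact.moduleCat_exact_iff_function_exact]
  exact hfg

/-- The first syzygy of a module with a projective resolution of length two. -/
theorem syzygy_shortExact (d₁ : P₁ →ₗ[R] P₀) (d₂ : P₂ →ₗ[R] P₁)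
    (hd : Function.Injective d₂) (h₁ : Function.Exact d₂ d₁) :
    (ShortComplex.mk (ModuleCat.ofHom d₂) (ModuleCat.ofHom d₁.rangeRestrict)
      (by ext x; exact h₁.apply_apply_eq_zero x)).ShortExact :=
  shortExact_of_linearMap d₂ d₁.rangeRestrict hd d₁.surjective_rangeRestrict fun y => by
    rw [← h₁ y, ← LinearMap.mem_ker, LinearMap.ker_rangeRestrict, LinearMap.mem_ker]

theorem augmentation_shortExact (ε : P₀ →ₗ[R] M) (d₁ : P₁ →ₗ[R] P₀)
    (hε : Function.Surjective ε) (h₀ : Function.Exact d₁ ε) :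
    (ShortComplex.mk (ModuleCat.ofHom (LinearMap.range d₁).subtype) (ModuleCat.ofHom ε)
      (by
        ext x
        obtain ⟨_, y, rfl⟩ := x
        exact h₀.apply_apply_eq_zero y)).ShortExact :=
  shortExact_of_linearMap _ ε (Submodule.subtype_injective _) hε fun y => by
    rw [h₀ y]; simp

/-- A module with a projective resolution of length two has projective dimension at most two. -/
theorem hasProjectiveDimensionLT_three [Module.Projective R P₀] [Module.Projective R P₁]
    [Module.Projective R P₂] (ε : P₀ →ₗ[R] M) (d₁ : P₁ →ₗ[R] P₀) (d₂ : P₂ →ₗ[R] P₁)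
    (hε : Function.Surjective ε) (h₀ : Function.Exact d₁ ε) (h₁ : Function.Exact d₂ d₁)
    (hd : Function.Injective d₂) :
    HasProjectiveDimensionLT (ModuleCat.of R M) 3 := by
  have p₀ : Projective (ModuleCat.of R P₀) := inferInstance
  have p₁ : Projective (ModuleCat.of R P₁) := inferInstance
  have p₂ : Projective (ModuleCat.of R P₂) := inferInstance
  have hK := ((syzygy_shortExact d₁ d₂ hd h₁).hasProjectiveDimensionLT_X₃_iff 0 p₁).2
    (inferInstanceAs (HasProjectiveDimensionLT (ModuleCat.of R P₂) 1))
  exact ((augmentation_shortExact ε d₁ hε h₀).hasProjectiveDimensionLT_X₃_iff 1 p₀).2 hK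

/-- If `Ext²(M, N) = 0`, then every map from the last term of a projective resolution
`0 → P₂ → P₁ → P₀ → M → 0` to `N` extends to `P₁`. -/
theorem exists_extension_of_subsingleton_ext_two [Module.Projective R P₀]
    {N : Type v} [AddCommGroup N] [Module R N]
    (ε : P₀ →ₗ[R] M) (d₁ : P₁ →ₗ[R] P₀) (d₂ : P₂ →ₗ[R] P₁)
    (hε : Function.Surjective ε) (h₀ : Function.Exact d₁ ε) (h₁ : Function.Exact d₂ d₁)
    (hd : Function.Injective d₂)
    (h : Subsingleton (Ext (ModuleCat.of R M) (ModuleCat.of R N) 2)) (φ : P₂ →ₗ[R] N) :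
    ∃ ψ : P₁ →ₗ[R] N, ψ ∘ₗ d₂ = φ := by
  have p₀ : Projective (ModuleCat.of R P₀) := inferInstance
  have hS := syzygy_shortExact d₁ d₂ hd h₁
  have hT := augmentation_shortExact ε d₁ hε h₀
  have hK : ∀ x : Ext (ModuleCat.of R (LinearMap.range d₁)) (ModuleCat.of R N) 1, x = 0 := by
    intro x
    obtain ⟨y, hy⟩ := Ext.contravariant_sequence_exact₁ hT (ModuleCat.of R N) x
      (n₁ := 2) rfl (Subsingleton.elim (α := Ext (ModuleCat.of R M) (ModuleCat.of R N) 2) _ _)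
    rw [← hy, y.eq_zero_of_projective, Ext.comp_zero]
  obtain ⟨y, hy⟩ := Ext.contravariant_sequence_exact₁ hS (ModuleCat.of R N)
    (Ext.mk₀ (ModuleCat.ofHom φ)) (n₁ := 1) rfl (hK _)
  obtain ⟨ψ, rfl⟩ := Ext.homEquiv₀.symm.surjective y
  refine ⟨ψ.hom, ?_⟩
  simp only [Ext.homEquiv₀_symm_apply, Ext.mk₀_comp_mk₀] at hy
  have := Ext.homEquiv₀.symm.injective hy
  simpa using congrArg ModuleCat.Hom.hom this

end Ext

end QuadAlg

/-! ### Graded free right modules and resolutions given by matrices -/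

namespace QuadAlg

section FreeModules

variable {k : Type u} [Field k] {A : Type v} [Ring A] [Algebra k A]

/-- Left multiplication of column vectors by the matrix `D`, a map of free right modules. -/
def matMap {ι κ : Type} [Fintype κ] (D : ι → κ → A) : (κ → A) →ₗ[Aᵐᵒᵖ] (ι → A) where
  toFun x i := ∑ j, D i j * x j
  map_add' x y := by ext i; simp [mul_add, Finset.sum_add_distrib]
  map_smul' a x := by ext i; simp [Finset.sum_mul, mul_assoc]

theorem matMap_apply {ι κ : Type} [Fintype κ] (D : ι → κ → A) (x : κ → A) (i : ι) :
    matMap D x i = ∑ j, D i j * x j := rfl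

theorem matMap_smul_base {ι κ : Type} [Fintype κ] (D : ι → κ → A) (c : k) (x : κ → A) :
    matMap D (c • x) = c • matMap D x := by
  ext i; simp [matMap_apply, Finset.smul_sum]

/-- The standard basis of the free right module `ι → A`. -/
noncomputable def rightBasis (A : Type v) [Ring A] (ι : Type) [Finite ι] :
    Module.Basis ι Aᵐᵒᵖ (ι → A) :=
  .ofEquivFun
    { toFun := fun x i => MulOpposite.op (x i)
      invFun := fun x i => (x i).unop
      left_inv := fun _ => rfl
      right_inv := fun _ => rfl
      map_add' := fun _ _ => rfl
      map_smul' := fun _ _ => rfl }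

theorem rightBasis_apply {ι : Type} [Finite ι] [DecidableEq ι] (i : ι) :
    rightBasis A ι i = Pi.single i 1 := by
  ext j
  simp only [rightBasis, Module.Basis.coe_ofEquivFun]
  change (Pi.single (M := fun _ => Aᵐᵒᵖ) i 1 j).unop = _
  by_cases h : j = i
  · subst h; simp
  · simp [h]

instance rightModule_projective {ι : Type} [Finite ι] : Module.Projective Aᵐᵒᵖ (ι → A) :=
  .of_basis (rightBasis A ι)

variable (𝒜 : ℕ → Submodule k A)

/-- The component of degree `m` of the graded module `A(-n)`. -/
def shift (n m : ℕ) : Submodule k A := if n ≤ m then 𝒜 (m - n) else ⊥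

theorem shift_add (n m : ℕ) : shift 𝒜 n (n + m) = 𝒜 m := by simp [shift]

theorem shift_of_lt {n m : ℕ} (h : m < n) : shift 𝒜 n m = ⊥ := by simp [shift, h]

/-- The component of degree `m` of the free graded right module `A(-n)^ι`. -/
def freeDeg (ι : Type) (n m : ℕ) : Submodule k (ι → A) := Submodule.pi Set.univ fun _ => shift 𝒜 n m

theorem mem_freeDeg {ι : Type} {n m : ℕ} {x : ι → A} :
    x ∈ freeDeg 𝒜 ι n m ↔ ∀ i, x i ∈ shift 𝒜 n m := by simp [freeDeg, Submodule.mem_pi]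

variable [GradedAlgebra 𝒜]

theorem shift_mul_mem {n m i : ℕ} {a b : A} (ha : a ∈ shift 𝒜 n m) (hb : b ∈ 𝒜 i) :
    a * b ∈ shift 𝒜 n (m + i) := by
  rcases lt_or_ge m n with h | h
  · rw [shift_of_lt 𝒜 h, Submodule.mem_bot] at ha
    simp [ha]
  · obtain ⟨m, rfl⟩ := Nat.exists_eq_add_of_le h
    rw [shift_add] at ha
    rw [add_assoc, shift_add]
    exact SetLike.mul_mem_graded ha hb

/-- The homogeneous component of degree `m` of an element of `A(-n)`. -/
noncomputable def shiftProj (n m : ℕ) (a : A) : A :=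
  if n ≤ m then GradedRing.proj 𝒜 (m - n) a else 0

theorem shiftProj_add (n m : ℕ) (a b : A) :
    shiftProj 𝒜 n m (a + b) = shiftProj 𝒜 n m a + shiftProj 𝒜 n m b := by
  unfold shiftProj; split_ifs <;> simp

theorem shiftProj_of_mem {n m l : ℕ} {a : A} (ha : a ∈ shift 𝒜 n l) :
    shiftProj 𝒜 n m a = if l = m then a else 0 := by
  rcases lt_or_ge l n with h | h
  · rw [shift_of_lt 𝒜 h, Submodule.mem_bot] at ha
    simp [ha, shiftProj]
  · obtain ⟨l, rfl⟩ := Nat.exists_eq_add_of_le h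
    rw [shift_add] at ha
    unfold shiftProj
    rw [GradedRing.proj_apply]
    split_ifs with h1 h2 h2
    · rw [show m - n = l by omega, DirectSum.decompose_of_mem_same 𝒜 ha]
    · exact DirectSum.decompose_of_mem_ne 𝒜 ha (by omega)
    · omega
    · rfl

theorem freeDeg_isInternal (ι : Type) [Fintype ι] (n : ℕ) :
    DirectSum.IsInternal (freeDeg 𝒜 ι n) := by
  classical
  constructor
  · refine (injective_iff_map_eq_zero _).2 fun z hz => ?_
    have key : ∀ (y : ⨁ m, freeDeg 𝒜 ι n m) (m : ℕ) (i : ι),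
        shiftProj 𝒜 n m (DirectSum.coeAddMonoidHom (freeDeg 𝒜 ι n) y i) =
          (y m : ι → A) i := by
      intro y m i
      induction y using DirectSum.induction_on with
      | zero => simp [shiftProj]
      | of l y =>
        rw [DirectSum.coeAddMonoidHom_of, shiftProj_of_mem 𝒜 ((mem_freeDeg 𝒜).1 y.2 i),
          DirectSum.coe_of_apply]
        split_ifs <;> rfl
      | add y z hy hz => simp [shiftProj_add, hy, hz]
    refine DFinsupp.ext fun m => Subtype.ext (funext fun i => ?_)
    rw [← key, hz]
    simp [shiftProj]
  · suffices h : ⨆ m, freeDeg 𝒜 ι n m = ⊤ by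
      rw [← DirectSum.range_coeLinearMap] at h
      exact LinearMap.range_eq_top.1 h
    rw [eq_top_iff]
    rintro x -
    rw [← Finset.univ_sum_single x]
    refine Submodule.sum_mem _ fun i _ => ?_
    induction x i using DirectSum.Decomposition.inductionOn 𝒜 with
    | zero => simp
    | @homogeneous m a =>
      refine Submodule.mem_iSup_of_mem (n + m) ((mem_freeDeg 𝒜).2 fun j => ?_)
      rw [shift_add]
      by_cases h : j = i
      · subst h; simp
      · simp [h]
    | add a b ha hb => rw [Pi.single_add]; exact add_mem ha hb

/-- The free graded right module `A(-n)^ι`. -/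
noncomputable def gradedFree (ι : Type) [Fintype ι] (n : ℕ) : GradedRightModule 𝒜 where
  carrier := ι → A
  deg := freeDeg 𝒜 ι n
  isInternal := freeDeg_isInternal 𝒜 ι n
  smul_mem _ _ _ _ ha hp := (mem_freeDeg 𝒜).2 fun l =>
    shift_mul_mem 𝒜 ((mem_freeDeg 𝒜).1 hp l) ha

theorem rightBasis_mem {ι : Type} [Finite ι] (n : ℕ) (i : ι) :
    rightBasis A ι i ∈ freeDeg 𝒜 ι n n := by
  classical
  rw [mem_freeDeg, rightBasis_apply]
  intro j
  have h1 : (1 : A) ∈ 𝒜 0 := SetLike.one_mem_graded 𝒜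
  by_cases h : j = i
  · subst h; simpa [shift]
  · simp [h]

theorem gradedFree_isFree (ι : Type) [Fintype ι] (n : ℕ) : (gradedFree 𝒜 ι n).IsFree :=
  ⟨Set.range (rightBasis A ι), by
    rintro _ ⟨i, rfl⟩
    exact ⟨n, rightBasis_mem 𝒜 n i⟩,
    (rightBasis A ι).linearIndependent.linearIndepOn_id, (rightBasis A ι).span_eq⟩

omit [GradedAlgebra 𝒜] in
theorem finiteDimensional_freeDeg (h0 : 𝒜 0 = 1) (ι : Type) [Fintype ι] (n : ℕ) :
    FiniteDimensional k (freeDeg 𝒜 ι n n) := by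
  have : FiniteDimensional k (𝒜 0) := by
    rw [h0, Submodule.one_eq_span]
    infer_instance
  let f : freeDeg 𝒜 ι n n →ₗ[k] (ι → 𝒜 0) :=
    { toFun := fun x i => ⟨x.1 i, by simpa [shift] using (mem_freeDeg 𝒜).1 x.2 i⟩
      map_add' := fun _ _ => rfl
      map_smul' := fun _ _ => rfl }
  refine Module.Finite.of_injective f fun x y h => ?_
  ext i
  exact congrArg Subtype.val (congrFun h i)

theorem matMap_mem {ι κ : Type} [Fintype κ] (D : ι → κ → A) (hD : ∀ i j, D i j ∈ 𝒜 1)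
    {n m : ℕ} {x : κ → A} (hx : x ∈ freeDeg 𝒜 κ (n + 1) m) : matMap D x ∈ freeDeg 𝒜 ι n m := by
  rw [mem_freeDeg] at hx ⊢
  refine fun i => Submodule.sum_mem _ fun j _ => ?_
  have := hx j
  rcases lt_or_ge m (n + 1) with h | h
  · rw [shift_of_lt 𝒜 h, Submodule.mem_bot] at this
    simp [this]
  · obtain ⟨m, rfl⟩ := Nat.exists_eq_add_of_le h
    rw [shift_add] at this
    rw [add_assoc, shift_add]
    exact SetLike.mul_mem_graded (hD i j) this

omit [GradedAlgebra 𝒜] in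
/-- If `A` is generated in degree one, a spanning row of `A₁` generates the augmentation ideal. -/
theorem augIdeal_eq_range {ι κ : Type} [Unique ι] [Fintype κ]
    (hgen : ∀ n, 𝒜 n = 𝒜 1 ^ n) (D : ι → κ → A)
    (hspan : Submodule.span k (Set.range (D default)) = 𝒜 1) (a : A) :
    a ∈ augIdeal 𝒜 ↔ ∃ y, matMap D y default = a := by
  classical
  constructor
  · intro ha
    induction ha using Submodule.span_induction with
    | mem a ha =>
      obtain ⟨n, hn, ha⟩ := ha
      obtain ⟨n, rfl⟩ := Nat.exists_eq_add_of_lt hn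
      rw [hgen, zero_add, pow_succ', ← hspan] at ha
      induction ha using Submodule.mul_induction_on' with
      | mem_mul_mem x hx z hz =>
        induction hx using Submodule.span_induction with
        | mem x hx =>
          obtain ⟨j, rfl⟩ := hx
          exact ⟨Pi.single j z, by simp [matMap_apply, Pi.single_apply]⟩
        | zero => exact ⟨0, by simp⟩
        | add x y _ _ hx hy =>
          obtain ⟨a, ha⟩ := hx
          obtain ⟨b, hb⟩ := hy
          exact ⟨a + b, by rw [map_add, Pi.add_apply, ha, hb, add_mul]⟩
        | smul c x _ hx =>
          obtain ⟨a, ha⟩ := hx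
          exact ⟨c • a, by rw [matMap_smul_base, Pi.smul_apply, ha, smul_mul_assoc]⟩
      | add x _ y _ hx hy =>
        obtain ⟨a, ha⟩ := hx
        obtain ⟨b, hb⟩ := hy
        exact ⟨a + b, by rw [map_add, Pi.add_apply, ha, hb]⟩
    | zero => exact ⟨0, by simp⟩
    | add x y _ _ hx hy =>
      obtain ⟨a, ha⟩ := hx
      obtain ⟨b, hb⟩ := hy
      exact ⟨a + b, by rw [map_add, Pi.add_apply, ha, hb]⟩
    | smul c x _ hx =>
      obtain ⟨a, ha⟩ := hx
      exact ⟨c • a, by rw [map_smul, Pi.smul_apply, ha]⟩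
  · rintro ⟨y, rfl⟩
    refine Submodule.sum_mem _ fun j _ => ?_
    have h1 : D default j ∈ augIdeal 𝒜 := Submodule.subset_span
      ⟨1, one_pos, hspan ▸ Submodule.subset_span ⟨j, rfl⟩⟩
    exact Submodule.smul_mem _ (MulOpposite.op (y j)) h1

/-- The augmentation `A^ι → k` for a one-element index set `ι`. -/
def augMap (ι : Type) [Unique ι] : (ι → A) →ₗ[Aᵐᵒᵖ] Triv 𝒜 :=
  (augIdeal 𝒜).mkQ ∘ₗ LinearMap.proj default

omit [GradedAlgebra 𝒜] in
theorem augMap_surjective (ι : Type) [Unique ι] : Function.Surjective (augMap 𝒜 ι) :=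
  (Submodule.mkQ_surjective _).comp fun a => ⟨fun _ => a, rfl⟩

omit [GradedAlgebra 𝒜] in
theorem exact_augMap {ι κ : Type} [Unique ι] [Fintype κ]
    (hgen : ∀ n, 𝒜 n = 𝒜 1 ^ n) (D : ι → κ → A)
    (hspan : Submodule.span k (Set.range (D default)) = 𝒜 1) :
    Function.Exact (matMap D) (augMap 𝒜 ι) := by
  intro x
  simp only [augMap, LinearMap.comp_apply, Submodule.mkQ_apply, Submodule.Quotient.mk_eq_zero,
    LinearMap.proj_apply, augIdeal_eq_range 𝒜 hgen D hspan]
  constructor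
  · rintro ⟨y, hy⟩
    exact ⟨y, funext fun i => by rw [Unique.eq_default i, hy]⟩
  · rintro ⟨y, rfl⟩
    exact ⟨y, rfl⟩

/-- An exact sequence of free modules given by matrices of elements of degree one, starting with a
spanning row of `A₁`, shows that `A` is Koszul. -/
theorem isKoszul_of_matrices (h0 : 𝒜 0 = 1) (hgen : ∀ n, 𝒜 n = 𝒜 1 ^ n)
    (ι : ℕ → Type) [∀ n, Fintype (ι n)] [Unique (ι 0)] (D : ∀ n, ι n → ι (n + 1) → A)
    (hD : ∀ n i j, D n i j ∈ 𝒜 1)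
    (hspan : Submodule.span k (Set.range (D 0 default)) = 𝒜 1)
    (hexact : ∀ n, Function.Exact (matMap (D (n + 1))) (matMap (D n))) : IsKoszul 𝒜 :=
  ⟨{P := fun n => gradedFree 𝒜 (ι n) n
    isFree := fun n => gradedFree_isFree 𝒜 (ι n) n
    finite := fun n => finiteDimensional_freeDeg 𝒜 h0 (ι n) n
    generated := fun n => by
      refine eq_top_mono (Submodule.span_mono ?_) (rightBasis A (ι n)).span_eq
      rintro _ ⟨i, rfl⟩
      exact rightBasis_mem 𝒜 n i
    d := fun n => matMap (D n)
    d_mem := fun n m p hp => matMap_mem 𝒜 (D n) (hD n) hp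
    ε := augMap 𝒜 (ι 0)
    ε_eq_zero := fun m p hm hp => by
      have := (mem_freeDeg 𝒜).1 hp default
      refine (Submodule.Quotient.mk_eq_zero _).2 (Submodule.subset_span ⟨m, hm, ?_⟩)
      simpa [shift] using this
    exact_d := hexact
    exact_ε := exact_augMap 𝒜 hgen (D 0) hspan
    surjective_ε := augMap_surjective 𝒜 (ι 0) }⟩

end FreeModules

end QuadAlg

/-! ### Linear filtrations and the resolution over `A` -/

namespace QuadAlg

section LinearFiltrations

variable {k : Type u} [Field k] {A : Type v} [Ring A] [Algebra k A]

/-- Right multiplication of a column vector over `A` by an element of `A`, as a bilinear map. -/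
def colMul (k : Type u) [Field k] (A : Type v) [Ring A] [Algebra k A] (ι : Type) :
    (ι → A) →ₗ[k] A →ₗ[k] (ι → A) :=
  LinearMap.mk₂ k (fun x a i => x i * a)
    (fun x y a => by ext i; simp [add_mul]) (fun c x a => by ext i; simp)
    (fun x a b => by ext i; simp [mul_add]) (fun c x a => by ext i; simp)

@[simp]
theorem colMul_apply {ι : Type} (x : ι → A) (a : A) (i : ι) : colMul k A ι x a i = x i * a := rfl

/-- The bilinear map `k^ι × A → A^ι` exhibiting `A^ι` as `k^ι ⊗ A`. -/
def colTensor (k : Type u) [Field k] (A : Type v) [Ring A] [Algebra k A] (ι : Type) :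
    (ι → k) →ₗ[k] A →ₗ[k] (ι → A) :=
  LinearMap.mk₂ k (fun c a i => c i • a)
    (fun x y a => by ext i; simp [add_smul]) (fun c x a => by ext i; simp [mul_smul])
    (fun x a b => by ext i; simp) (fun c x a => by ext i; exact smul_comm _ _ _)

@[simp]
theorem colTensor_apply {ι : Type} (c : ι → k) (a : A) (i : ι) :
    colTensor k A ι c a i = c i • a := rfl

/-- The `k`-linear combinations of the columns of a matrix. -/
def colComb (k : Type u) [Field k] {A : Type v} [Ring A] [Algebra k A] {ι κ : Type} [Fintype κ]
    (D : ι → κ → A) : (κ → k) →ₗ[k] (ι → A) :=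
  Fintype.linearCombination k fun j i => D i j

theorem colComb_apply {ι κ : Type} [Fintype κ] (D : ι → κ → A) (c : κ → k) (i : ι) :
    colComb k D c i = ∑ j, c j • D i j := by
  simp [colComb, Fintype.linearCombination_apply]

theorem matMap_colTensor {ι κ : Type} [Fintype κ] (D : ι → κ → A) (c : κ → k) (a : A) :
    matMap D (colTensor k A κ c a) = colMul k A ι (colComb k D c) a := by
  ext i
  simp [matMap_apply, colComb_apply, Finset.sum_mul]

theorem colMul_colTensor {ι : Type} (c : ι → k) (a b : A) :
    colMul k A ι (colTensor k A ι c a) b = colTensor k A ι c (a * b) := by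
  ext i; simp

/-- The column vectors with entries in `X`. -/
def colSpace (ι : Type) (X : Submodule k A) : Submodule k (ι → A) :=
  Submodule.pi Set.univ fun _ => X

theorem mem_colSpace {ι : Type} {X : Submodule k A} {x : ι → A} :
    x ∈ colSpace ι X ↔ ∀ i, x i ∈ X := by simp [colSpace, Submodule.mem_pi]

theorem map₂_colTensor_top (ι : Type) [Finite ι] (X : Submodule k A) :
    Submodule.map₂ (colTensor k A ι) ⊤ X = colSpace ι X := by
  classical
  have := Fintype.ofFinite ι
  refine le_antisymm (Submodule.map₂_le.2 fun c _ a ha => mem_colSpace.2 fun i =>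
    X.smul_mem _ ha) fun x hx => ?_
  rw [← Finset.univ_sum_single x]
  refine Submodule.sum_mem _ fun i _ => ?_
  have : (Pi.single i (x i) : ι → A) = colTensor k A ι (Pi.single i 1) (x i) := by
    ext j
    by_cases h : j = i
    · subst h; simp
    · simp [h]
  rw [this]
  exact Submodule.apply_mem_map₂ _ trivial (mem_colSpace.1 hx i)

theorem colSpace_mul_le (ι : Type) [Finite ι] (X Y : Submodule k A) :
    colSpace ι (X * Y) ≤ Submodule.map₂ (colMul k A ι) (colSpace ι X) Y := by
  rw [← map₂_colTensor_top, ← map₂_colTensor_top, Submodule.map₂_le]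
  intro c hc a ha
  induction ha using Submodule.mul_induction_on' with
  | mem_mul_mem x hx y hy =>
    rw [← colMul_colTensor]
    exact Submodule.apply_mem_map₂ _ (Submodule.apply_mem_map₂ _ hc hx) hy
  | add x _ y _ hx hy => rw [map_add]; exact add_mem hx hy

theorem map₂_colMul_colSpace_le (ι : Type) (X Y : Submodule k A) :
    Submodule.map₂ (colMul k A ι) (colSpace ι X) Y ≤ colSpace ι (X * Y) :=
  Submodule.map₂_le.2 fun _ hx _ ha => mem_colSpace.2 fun i =>
    Submodule.mul_mem_mul (mem_colSpace.1 hx i) ha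

/-- A space `F` of column vectors over `A` admits a *linear filtration* with respect to `U` and `W`
if there is a finite flag `0 = F₀ ⊆ F₁ ⊆ ⋯ ⊆ Fₘ = F` with `Fᵢ₊₁ U ⊆ Fᵢ W`. -/
inductive LinFilt (U W : Submodule k A) {ι : Type} : Submodule k (ι → A) → Prop
  | bot : LinFilt U W ⊥
  | step (F F' : Submodule k (ι → A)) (hF : LinFilt U W F) (hle : F ≤ F')
      (h : Submodule.map₂ (colMul k A ι) F' U ≤ Submodule.map₂ (colMul k A ι) F W) :
      LinFilt U W F'

section Syzygies

variable {ι κ : Type} [Fintype κ] (D : ι → κ → A)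

/-- The subspace `F ⊗ X` of `A^κ`, for a subspace `F` of the span of the columns of `D`, identified
with a subspace of `k^κ`. -/
def subTensor (F : Submodule k (ι → A)) (X : Submodule k A) : Submodule k (κ → A) :=
  Submodule.map₂ (colTensor k A κ) (F.comap (colComb k D)) X

/-- The kernel of multiplication by the matrix `D`, as a `k`-subspace. -/
def matKer (k : Type u) [Field k] {A : Type v} [Ring A] [Algebra k A] {ι κ : Type} [Fintype κ]
    (D : ι → κ → A) : Submodule k (κ → A) :=
  LinearMap.ker ((matMap D).restrictScalars k)

theorem mem_matKer {x : κ → A} : x ∈ matKer k D ↔ matMap D x = 0 := Iff.rfl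

theorem subTensor_mono {F F' : Submodule k (ι → A)} {X X' : Submodule k A} (hF : F ≤ F')
    (hX : X ≤ X') : subTensor D F X ≤ subTensor D F' X' :=
  Submodule.map₂_le_map₂ (Submodule.comap_mono hF) hX

theorem subTensor_mul_le (F : Submodule k (ι → A)) (X Y : Submodule k A) :
    Submodule.map₂ (colMul k A κ) (subTensor D F X) Y ≤ subTensor D F (X * Y) := by
  refine Submodule.map₂_le.2 fun x hx b hb => ?_
  have : subTensor D F X ≤ (subTensor D F (X * Y)).comap ((colMul k A κ).flip b) :=
    Submodule.map₂_le.2 fun c hc a ha => by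
      rw [Submodule.mem_comap, LinearMap.flip_apply, colMul_colTensor]
      exact Submodule.apply_mem_map₂ _ hc (Submodule.mul_mem_mul ha hb)
  exact this hx

theorem exists_matMap_eq {F : Submodule k (ι → A)} (hF : F ≤ LinearMap.range (colComb k D))
    {X : Submodule k A} {y : ι → A} (hy : y ∈ Submodule.map₂ (colMul k A ι) F X) :
    ∃ z ∈ subTensor D F X, matMap D z = y := by
  have : Submodule.map₂ (colMul k A ι) F X ≤
      (subTensor D F X).map ((matMap D).restrictScalars k) :=
    Submodule.map₂_le.2 fun f hf a ha => by
      obtain ⟨c, rfl⟩ := hF hf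
      exact ⟨_, Submodule.apply_mem_map₂ _ hf ha, matMap_colTensor D c a⟩
  exact this hy

/-- The inductive step of the construction of the resolution over `A`: a linear filtration of a
space `F` of columns induces one, of twice the length, of the linear syzygies of `F`, and all
syzygies in degree two are generated by the linear ones. -/
theorem LinFilt.syzygies {U W A₁ A₂ : Submodule k A} (hU : U ≤ A₁) (hW : W ≤ A₁)
    (hmul : A₁ * A₁ ≤ A₂) (hUW : U * W = A₂) (hUU : U * U = ⊥)
    (hinj : Function.Injective (colComb k D)) {F : Submodule k (ι → A)} (hF : LinFilt U W F)
    (hr : F ≤ LinearMap.range (colComb k D)) :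
    LinFilt U W (matKer k D ⊓ subTensor D F A₁) ∧
      subTensor D F A₂ ≤
        Submodule.map₂ (colMul k A κ) (matKer k D ⊓ subTensor D F A₁) W := by
  induction hF with
  | bot =>
    have h : ∀ X : Submodule k A, subTensor D ⊥ X = ⊥ := fun X => by
      rw [subTensor, Submodule.comap_bot, LinearMap.ker_eq_bot.2 hinj, Submodule.map₂_bot_left]
    rw [h, h, inf_bot_eq]
    exact ⟨.bot, bot_le⟩
  | step F F' hF hle hFU ih =>
    obtain ⟨ih₁, ih₂⟩ := ih (hle.trans hr)
    set G := matKer k D ⊓ subTensor D F A₁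
    set H := matKer k D ⊓ (subTensor D F A₁ ⊔ subTensor D F' U)
    set G' := matKer k D ⊓ subTensor D F' A₁
    have hGH : G ≤ H := inf_le_inf_left _ le_sup_left
    have hHG : H ≤ G' := inf_le_inf_left _
      (sup_le (subTensor_mono D hle le_rfl) (subTensor_mono D le_rfl hU))
    have hH : LinFilt U W H := by
      refine .step G H ih₁ hGH ?_
      refine (Submodule.map₂_le_map₂_left inf_le_right).trans ?_
      rw [Submodule.map₂_sup_left]
      refine sup_le ?_ ?_
      · refine (subTensor_mul_le D F A₁ U).trans (le_trans ?_ ih₂)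
        exact subTensor_mono D le_rfl ((mul_le_mul_right hU A₁).trans hmul)
      · refine (subTensor_mul_le D F' U U).trans ?_
        rw [hUU, subTensor, Submodule.map₂_bot_right]
        exact bot_le
    have hHW : subTensor D F' A₂ ≤ Submodule.map₂ (colMul k A κ) H W := by
      refine Submodule.map₂_le.2 fun c hc a ha => ?_
      rw [← hUW] at ha
      induction ha using Submodule.mul_induction_on' with
      | add x _ y _ hx hy => rw [map_add]; exact add_mem hx hy
      | mem_mul_mem x hx y hy =>
        -- correct `c ⊗ x` by an element of `F ⊗ W` so that it becomes a syzygy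
        obtain ⟨z, hz, hzx⟩ := exists_matMap_eq D (hle.trans hr)
          (hFU (Submodule.apply_mem_map₂ _ hc hx))
        have hmem : colTensor k A κ c x - z ∈ H := by
          refine ⟨?_, sub_mem (Submodule.mem_sup_right (Submodule.apply_mem_map₂ _ hc hx))
            (Submodule.mem_sup_left (subTensor_mono D le_rfl hW hz))⟩
          rw [SetLike.mem_coe, mem_matKer, map_sub, hzx, matMap_colTensor, sub_self]
        have hzy : colMul k A κ z y ∈ Submodule.map₂ (colMul k A κ) H W := by
          refine Submodule.map₂_le_map₂_left hGH (ih₂ ?_)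
          refine subTensor_mono D le_rfl ((mul_le_mul' hW hW).trans hmul)
            (subTensor_mul_le D F W W ?_)
          exact Submodule.apply_mem_map₂ _ hz hy
        have := add_mem (Submodule.apply_mem_map₂ (colMul k A κ) hmem hy) hzy
        rwa [map_sub, LinearMap.sub_apply, sub_add_cancel, colMul_colTensor] at this
    refine ⟨.step H G' hH hHG (le_trans ?_ hHW), hHW.trans (Submodule.map₂_le_map₂_left hHG)⟩
    refine (Submodule.map₂_le_map₂_left inf_le_right).trans
      ((subTensor_mul_le D F' A₁ U).trans ?_)
    exact subTensor_mono D le_rfl ((mul_le_mul_right hU A₁).trans hmul)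

end Syzygies

end LinearFiltrations

section Resolution

variable {k : Type u} [Field k] {A : Type v} [Ring A] [Algebra k A] (𝒜 : ℕ → Submodule k A)

/-- A finitely generated space of columns of elements of degree one with a linear filtration,
which generates the columns of elements of degree two. The right submodules generated by such
spaces are the syzygy modules in the resolution of the trivial module. -/
structure SyzygySpace (U W : Submodule k A) where
  /-- the number of entries of the columns -/
  s : ℕ
  /-- the space of columns -/
  N : Submodule k (Fin s → A)
  le : N ≤ colSpace (Fin s) (𝒜 1)
  linFilt : LinFilt U W N
  gen : colSpace (Fin s) (𝒜 2) ≤ Submodule.map₂ (colMul k A (Fin s)) N W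

namespace SyzygySpace

variable {𝒜} {U W : Submodule k A} (S : SyzygySpace 𝒜 U W)

theorem finiteDimensional [FiniteDimensional k (𝒜 1)] : FiniteDimensional k S.N := by
  let f : S.N →ₗ[k] (Fin S.s → 𝒜 1) :=
    { toFun := fun x i => ⟨x.1 i, mem_colSpace.1 (S.le x.2) i⟩
      map_add' := fun _ _ => rfl
      map_smul' := fun _ _ => rfl }
  refine Module.Finite.of_injective f fun x y h => ?_
  ext i
  exact congrArg Subtype.val (congrFun h i)

variable [FiniteDimensional k (𝒜 1)]

/-- The number of columns in a basis of a syzygy space. -/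
noncomputable def rank : ℕ := Module.finrank k S.N

/-- A basis of a syzygy space. -/
noncomputable def basis : Module.Basis (Fin S.rank) k S.N :=
  have := S.finiteDimensional
  Module.finBasis k S.N

/-- The matrix whose columns are a basis of the syzygy space. -/
noncomputable def mat : Fin S.s → Fin S.rank → A := fun i j => (S.basis j : Fin S.s → A) i

theorem mat_mem (i : Fin S.s) (j : Fin S.rank) : S.mat i j ∈ 𝒜 1 :=
  mem_colSpace.1 (S.le (S.basis j).2) i

theorem colComb_mat_eq :
    colComb k S.mat = S.N.subtype ∘ₗ (S.basis.equivFun.symm : _ →ₗ[k] S.N) := by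
  ext c i
  simp [colComb_apply, mat, Module.Basis.equivFun_symm_apply]

theorem colComb_mat_injective : Function.Injective (colComb k S.mat) := by
  rw [colComb_mat_eq]
  exact (Submodule.subtype_injective _).comp S.basis.equivFun.symm.injective

theorem range_colComb_mat : LinearMap.range (colComb k S.mat) = S.N := by
  rw [colComb_mat_eq, LinearMap.range_comp, LinearEquiv.range, Submodule.map_subtype_top]

theorem span_mat [Unique (Fin S.s)] :
    Submodule.span k (Set.range (S.mat default)) = S.N.map (LinearMap.proj default) := by
  rw [← S.range_colComb_mat, ← LinearMap.range_comp]
  ext x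
  rw [Submodule.mem_span_range_iff_exists_fun]
  simp [LinearMap.mem_range, colComb_apply]

theorem subTensor_mat (X : Submodule k A) :
    subTensor S.mat S.N X = colSpace (Fin S.rank) X := by
  have : S.N.comap (colComb k S.mat) = ⊤ := by
    rw [eq_top_iff, ← Submodule.map_le_iff_le_comap, Submodule.map_top, S.range_colComb_mat]
  rw [subTensor, this, map₂_colTensor_top]

/-- The next syzygy space: the linear relations between the columns of a basis. -/
noncomputable def next (hU : U ≤ 𝒜 1) (hW : W ≤ 𝒜 1) (hmul : 𝒜 1 * 𝒜 1 ≤ 𝒜 2)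
    (hUW : U * W = 𝒜 2) (hUU : U * U = ⊥) : SyzygySpace 𝒜 U W where
  s := S.rank
  N := matKer k S.mat ⊓ colSpace (Fin S.rank) (𝒜 1)
  le := inf_le_right
  linFilt := by
    have := (S.linFilt.syzygies S.mat hU hW hmul hUW hUU S.colComb_mat_injective
      S.range_colComb_mat.ge).1
    rwa [subTensor_mat] at this
  gen := by
    have := (S.linFilt.syzygies S.mat hU hW hmul hUW hUU S.colComb_mat_injective
      S.range_colComb_mat.ge).2
    rwa [subTensor_mat, subTensor_mat] at this

theorem mem_range_of_mem_N {x : Fin S.s → A} (hx : x ∈ S.N) (a : A) :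
    ∃ y, matMap S.mat y = colMul k A (Fin S.s) x a := by
  rw [← S.range_colComb_mat] at hx
  obtain ⟨c, rfl⟩ := hx
  exact ⟨_, matMap_colTensor S.mat c a⟩

theorem mem_range_of_mem_map₂ {X : Submodule k A} {x : Fin S.s → A}
    (hx : x ∈ Submodule.map₂ (colMul k A (Fin S.s)) S.N X) :
    x ∈ LinearMap.range (matMap S.mat) := by
  have : Submodule.map₂ (colMul k A (Fin S.s)) S.N X ≤
      (LinearMap.range (matMap S.mat)).restrictScalars k :=
    Submodule.map₂_le.2 fun x hx a _ => S.mem_range_of_mem_N hx a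
  exact this hx

theorem exact_mat_next [GradedAlgebra 𝒜] (h0 : 𝒜 0 = 1) (hbig : ∀ n, 3 ≤ n → 𝒜 n = ⊥)
    (hU : U ≤ 𝒜 1) (hW : W ≤ 𝒜 1) (hmul : 𝒜 1 * 𝒜 1 ≤ 𝒜 2)
    (hUW : U * W = 𝒜 2) (hUU : U * U = ⊥) :
    Function.Exact (matMap (S.next hU hW hmul hUW hUU).mat) (matMap S.mat) := by
  set S' := S.next hU hW hmul hUW hUU
  intro (x : Fin S.rank → A)
  constructor
  · intro hx
    have hx' : ∀ i, ∑ j, S.mat i j * x j = 0 := fun i => congrFun hx i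
    -- split `x` into homogeneous components, each of which is a syzygy
    let c : ℕ → Fin S.rank → A := fun m i => GradedRing.proj 𝒜 m (x i)
    have hc : ∀ m, matMap S.mat (c m) = 0 := fun m => by
      ext i
      have := congrArg (GradedRing.proj 𝒜 (1 + m)) (hx' i)
      rw [map_sum, map_zero] at this
      rw [matMap_apply, Pi.zero_apply, ← this]
      refine Finset.sum_congr rfl fun j _ => ?_
      rw [GradedRing.proj_apply, DirectSum.coe_decompose_mul_add_of_left_mem 𝒜 (S.mat_mem i j)]
      rfl
    have hmem : ∀ m, c m ∈ colSpace (Fin S.rank) (𝒜 m) := fun m =>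
      mem_colSpace.2 fun i => SetLike.coe_mem _
    have hsum : x = c 0 + c 1 + c 2 := by
      have key : ∀ a : A, a = GradedRing.proj 𝒜 0 a + GradedRing.proj 𝒜 1 a
          + GradedRing.proj 𝒜 2 a := fun a => by
        induction a using DirectSum.Decomposition.inductionOn 𝒜 with
        | zero => simp
        | @homogeneous m a =>
          simp only [GradedRing.proj_apply]
          rcases lt_or_ge m 3 with h | h
          · interval_cases m <;> simp [DirectSum.decompose_coe, DirectSum.coe_of_apply]
          · have : (a : A) = 0 := by simpa [hbig m h] using a.2
            simp [this]
        | add a b ha hb =>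
          simp only [map_add]
          nth_rewrite 1 [ha, hb]
          abel
      exact funext fun i => key (x i)
    have hc0 : c 0 = 0 := by
      have : ∀ i, ∃ r : k, algebraMap k A r = c 0 i := fun i => by
        have := mem_colSpace.1 (hmem 0) i
        rwa [h0, Submodule.mem_one] at this
      choose r hr using this
      have hr' : c 0 = colTensor k A _ r 1 := by
        ext i; rw [← hr i, colTensor_apply, Algebra.algebraMap_eq_smul_one]
      have h := hc 0
      rw [hr', matMap_colTensor] at h
      have : colComb k S.mat r = 0 := by
        ext i; simpa using congrFun h i
      rw [hr', S.colComb_mat_injective (this.trans (map_zero _).symm)]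
      simp
    have hc1 : c 1 ∈ LinearMap.range (matMap S'.mat) := by
      obtain ⟨y, hy⟩ := S'.mem_range_of_mem_N (x := c 1) ⟨hc 1, hmem 1⟩ 1
      exact ⟨y, by rw [hy]; ext i; exact mul_one _⟩
    have hc2 : c 2 ∈ LinearMap.range (matMap S'.mat) := S'.mem_range_of_mem_map₂ (S'.gen (hmem 2))
    rw [hsum, hc0, zero_add]
    exact add_mem hc1 hc2
  · rintro ⟨y, rfl⟩
    have : matMap S'.mat y = ∑ j, MulOpposite.op (y j) • (S'.basis j).1 := by
      ext i
      rw [matMap_apply, Finset.sum_apply]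
      rfl
    rw [this]
    have hsum : ∀ b : Fin S'.rank → Fin S.rank → A, (∀ j, matMap S.mat (b j) = 0) →
        matMap S.mat (∑ j, MulOpposite.op (y j) • b j) = 0 := fun b hb => by
      simp [map_sum, hb]
    exact hsum (fun j => (S'.basis j).1) fun j => (S'.basis j).2.1

end SyzygySpace

/-- The augmentation ideal as a syzygy space, with the flag `0 ⊆ U ⊆ A₁`. -/
def SyzygySpace.augmentation {U W : Submodule k A} (hU : U ≤ 𝒜 1)
    (hmul : 𝒜 1 * 𝒜 1 ≤ 𝒜 2) (hUW : U * W = 𝒜 2) (hUU : U * U = ⊥) : SyzygySpace 𝒜 U W where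
  s := 1
  N := colSpace (Fin 1) (𝒜 1)
  le := le_rfl
  linFilt := by
    refine .step (colSpace (Fin 1) U) _ (.step ⊥ _ .bot bot_le ?_) ?_ ?_
    · refine (map₂_colMul_colSpace_le _ _ _).trans ?_
      rw [hUU]
      intro x hx
      rw [show x = 0 from funext fun i => by simpa using mem_colSpace.1 hx i]
      exact zero_mem _
    · exact fun x hx => mem_colSpace.2 fun i => hU (mem_colSpace.1 hx i)
    · refine (map₂_colMul_colSpace_le _ _ _).trans (le_trans ?_ (colSpace_mul_le _ _ _))
      refine fun x hx => mem_colSpace.2 fun i => ?_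
      rw [hUW]
      exact hmul (mul_le_mul_right hU (𝒜 1) (mem_colSpace.1 hx i))
  gen := by
    rw [← hUW]
    exact (colSpace_mul_le _ _ _).trans (Submodule.map₂_le_map₂_left
      fun x hx => mem_colSpace.2 fun i => hU (mem_colSpace.1 hx i))

/-- The sequence of syzygy spaces in the resolution of the trivial module. -/
noncomputable def SyzygySpace.seq [FiniteDimensional k (𝒜 1)] {U W : Submodule k A}
    (hU : U ≤ 𝒜 1) (hW : W ≤ 𝒜 1)
    (hmul : 𝒜 1 * 𝒜 1 ≤ 𝒜 2) (hUW : U * W = 𝒜 2) (hUU : U * U = ⊥) : ℕ → SyzygySpace 𝒜 U W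
  | 0 => .augmentation 𝒜 hU hmul hUW hUU
  | n + 1 => (seq hU hW hmul hUW hUU n).next hU hW hmul hUW hUU

/-- A connected algebra generated in degree one with `A₁ ⊇ U, W`, `A₂ = UW` and `UU = 0` is
Koszul. -/
theorem isKoszul_of_mul_eq [GradedAlgebra 𝒜] [FiniteDimensional k (𝒜 1)] (h0 : 𝒜 0 = 1)
    (hgen : ∀ n, 𝒜 n = 𝒜 1 ^ n) (hbig : ∀ n, 3 ≤ n → 𝒜 n = ⊥) {U W : Submodule k A}
    (hU : U ≤ 𝒜 1) (hW : W ≤ 𝒜 1) (hUW : U * W = 𝒜 2) (hUU : U * U = ⊥) : IsKoszul 𝒜 := by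
  have hmul : 𝒜 1 * 𝒜 1 ≤ 𝒜 2 := by rw [hgen 2, pow_two]
  let _ : Unique (Fin (SyzygySpace.seq 𝒜 hU hW hmul hUW hUU 0).s) :=
    inferInstanceAs (Unique (Fin 1))
  refine isKoszul_of_matrices 𝒜 h0 hgen (fun n => Fin (SyzygySpace.seq 𝒜 hU hW hmul hUW hUU n).s)
    (fun n => (SyzygySpace.seq 𝒜 hU hW hmul hUW hUU n).mat) (fun n => SyzygySpace.mat_mem _) ?_
    fun n => SyzygySpace.exact_mat_next _ h0 hbig hU hW hmul hUW hUU
  refine (SyzygySpace.span_mat _).trans ?_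
  ext a
  constructor
  · rintro ⟨x, hx, rfl⟩
    exact mem_colSpace.1 hx _
  · exact fun ha => ⟨fun _ => a, mem_colSpace.2 fun _ => ha, rfl⟩

end Resolution

end QuadAlg

/-! ### The first terms of the resolution over a quadratic algebra -/

namespace QuadAlg

section QuadraticComplex

variable {k : Type u} [Field k] {V : Type w} [AddCommGroup V] [Module k V]

/-- The rows of an element of `V ⊗ V` with respect to a basis of the first factor:
`x = ∑ i, b i ⊗ row b i x`. -/
noncomputable def row {β : Type} (b : Module.Basis β k V) (i : β) : V ⊗[k] V →ₗ[k] V :=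
  TensorProduct.lid k V ∘ₗ (b.coord i).rTensor V

@[simp]
theorem row_tmul {β : Type} (b : Module.Basis β k V) (i : β) (x y : V) :
    row b i (x ⊗ₜ y) = b.repr x i • y := by simp [row]

theorem sum_tmul_row {β : Type} [Fintype β] (b : Module.Basis β k V) (x : V ⊗[k] V) :
    ∑ i, b i ⊗ₜ row b i x = x := by
  induction x with
  | zero => simp
  | add x y hx hy => simp only [map_add, TensorProduct.tmul_add, Finset.sum_add_distrib, hx, hy]
  | tmul x y =>
    simp only [row_tmul, ← TensorProduct.smul_tmul, ← TensorProduct.sum_tmul, b.sum_repr]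

variable (Ω : Submodule k (V ⊗[k] V))

/-- The representation of `Q(V, Ω)` on `k × V` by `v · (c, w) = (0, c v)`. -/
noncomputable def Quad.truncRep : Quad Ω →ₐ[k] Module.End k (k × V) :=
  RingQuot.liftAlgHom k ⟨TensorAlgebra.lift k
    { toFun := fun v => LinearMap.inr k k V ∘ₗ (LinearMap.fst k k V).smulRight v
      map_add' := fun v w => by ext <;> simp
      map_smul' := fun c v => by ext <;> simp }, by
    rintro _ _ ⟨x, hx⟩
    rw [map_zero]
    clear hx
    induction x with
    | zero => simp
    | add x y hx hy => rw [map_add, map_add, hx, hy, add_zero]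
    | tmul x y =>
      simp only [tensorSq, LinearMap.comp_apply, TensorProduct.map_tmul, LinearMap.mul'_apply,
        map_mul, TensorAlgebra.lift_ι_apply]
      ext <;> simp⟩

theorem Quad.ι_injective : Function.Injective (Quad.ι Ω) := by
  have h : ∀ v, Quad.truncRep Ω (Quad.ι Ω v) (1, 0) = (0, v) := fun v => by
    simp [Quad.truncRep, Quad.ι]
  intro v w hvw
  have := h v
  rw [hvw, h w] at this
  exact (congrArg Prod.snd this).symm

instance Quad.nontrivial : Nontrivial (Quad Ω) := by
  refine ⟨1, 0, fun h => ?_⟩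
  have := congrArg (fun f : Module.End k (k × V) => (f (1, 0)).1)
    (congrArg (Quad.truncRep Ω) h)
  simp at this

theorem Quad.grading_zero : Quad.grading Ω 0 = 1 := pow_zero _

theorem Quad.grading_eq_pow (n : ℕ) : Quad.grading Ω n = Quad.grading Ω 1 ^ n := by
  simp [Quad.grading]

variable {β : Type} [Fintype β] (b : Module.Basis β k V)

/-- The row of generators of `Q(V, Ω)`. -/
noncomputable def genMat : Unit → β → Quad Ω := fun _ i => Quad.ι Ω (b i)

/-- The matrix of relations of `Q(V, Ω)`: the entry at `(i, j)` is the `i`-th row of the `j`-th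
relation. -/
noncomputable def relMat {κ : Type} (r : Module.Basis κ k Ω) : β → κ → Quad Ω :=
  fun i j => Quad.ι Ω (row b i (r j))

theorem Quad.sum_ι_repr (v : V) : ∑ i, b.repr v i • Quad.ι Ω (b i) = Quad.ι Ω v := by
  conv_rhs => rw [← b.sum_repr v, map_sum]
  simp

theorem Quad.sum_ι_mul_row (x : V ⊗[k] V) :
    ∑ i, Quad.ι Ω (b i) * Quad.ι Ω (row b i x) =
      RingQuot.mkAlgHom k (Rel Ω) (tensorSq k V x) := by
  conv_rhs => rw [← sum_tmul_row b x, map_sum, map_sum]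
  simp [tensorSq, Quad.ι]

theorem Quad.mk_tensorSq_of_mem {x : V ⊗[k] V} (hx : x ∈ Ω) :
    RingQuot.mkAlgHom k (Rel Ω) (tensorSq k V x) = 0 := by
  rw [RingQuot.mkAlgHom_rel k (Rel.of x hx), map_zero]

variable {κ : Type} [Fintype κ] (r : Module.Basis κ k Ω)

theorem genMat_relMat (y : κ → Quad Ω) : matMap (genMat Ω b) (matMap (relMat Ω b r) y) = 0 := by
  ext
  simp only [matMap_apply, genMat, relMat, Finset.mul_sum, ← mul_assoc, Pi.zero_apply]
  rw [Finset.sum_comm]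
  refine Finset.sum_eq_zero fun j _ => ?_
  rw [← Finset.sum_mul, Quad.sum_ι_mul_row, Quad.mk_tensorSq_of_mem Ω (r j).2, zero_mul]

/-- The space of relations between the generators of `Q(V, Ω)` coming from `Ω`. -/
noncomputable def relSpace : Submodule k (β → Quad Ω) :=
  LinearMap.range ((matMap (relMat Ω b r)).restrictScalars k)

omit [Fintype β] in
theorem row_mul_mem_relSpace {x : V ⊗[k] V} (hx : x ∈ Ω) (a : Quad Ω) :
    (fun i => Quad.ι Ω (row b i x) * a) ∈ relSpace Ω b r := by
  refine ⟨fun j => r.repr ⟨x, hx⟩ j • a, funext fun i => ?_⟩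
  have : x = ∑ j, r.repr ⟨x, hx⟩ j • (r j : V ⊗[k] V) := by
    have := congrArg Ω.subtype (r.sum_repr ⟨x, hx⟩)
    rw [map_sum] at this
    exact this.symm
  conv_rhs => rw [this]
  simp [matMap_apply, relMat, Finset.sum_mul]

/-- The map `k ⊕ (B^β / relations) → B`, for `B = Q(V, Ω)`; it turns out to be bijective. -/
noncomputable def recVal : (k × ((β → Quad Ω) ⧸ relSpace Ω b r)) →ₗ[k] Quad Ω :=
  (Algebra.linearMap k (Quad Ω)).coprod ((relSpace Ω b r).liftQ
    (LinearMap.proj () ∘ₗ (matMap (genMat Ω b)).restrictScalars k) (by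
      rintro _ ⟨y, rfl⟩
      exact congrFun (genMat_relMat Ω b r y) ()))

/-- The action of `v ∈ V` on `k ⊕ (B^β / relations)`, lifting left multiplication by `v`. -/
noncomputable def recAct : V →ₗ[k] Module.End k (k × ((β → Quad Ω) ⧸ relSpace Ω b r)) :=
  LinearMap.mk₂ k (fun v e => (0, (relSpace Ω b r).mkQ fun i => b.repr v i • recVal Ω b r e))
    (fun v w e => by
      rw [Prod.mk_add_mk, ← map_add, add_zero]
      congr 2; ext i; simp [add_smul])
    (fun c v e => by
      rw [Prod.smul_mk, ← map_smul, smul_zero]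
      congr 2; ext i; simp [mul_smul])
    (fun v e f => by
      rw [map_add (recVal Ω b r), Prod.mk_add_mk, ← map_add, add_zero]
      refine congrArg (fun x => (0, (relSpace Ω b r).mkQ x)) ?_
      ext i; simp)
    (fun c v e => by
      rw [map_smul (recVal Ω b r), Prod.smul_mk, ← map_smul (relSpace Ω b r).mkQ, smul_zero]
      refine congrArg (fun x => (0, (relSpace Ω b r).mkQ x)) ?_
      ext i; exact smul_comm (b.repr v i) c (recVal Ω b r e))

theorem recAct_apply (v : V) (e : k × ((β → Quad Ω) ⧸ relSpace Ω b r)) :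
    recAct Ω b r v e = (0, (relSpace Ω b r).mkQ fun i => b.repr v i • recVal Ω b r e) := rfl

theorem recVal_mk (c : k) (x : β → Quad Ω) :
    recVal Ω b r (c, (relSpace Ω b r).mkQ x) =
      algebraMap k (Quad Ω) c + ∑ i, Quad.ι Ω (b i) * x i := by
  simp [recVal, matMap_apply, genMat]

theorem recVal_recAct (v : V) (e : k × ((β → Quad Ω) ⧸ relSpace Ω b r)) :
    recVal Ω b r (recAct Ω b r v e) = Quad.ι Ω v * recVal Ω b r e := by
  rw [recAct_apply, recVal_mk, map_zero, zero_add, ← Quad.sum_ι_repr Ω b v, Finset.sum_mul]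
  exact Finset.sum_congr rfl fun i _ => by simp

theorem lift_recAct_tensorSq (x : V ⊗[k] V) (e : k × ((β → Quad Ω) ⧸ relSpace Ω b r)) :
    TensorAlgebra.lift k (recAct Ω b r) (tensorSq k V x) e =
      (0, (relSpace Ω b r).mkQ fun i => Quad.ι Ω (row b i x) * recVal Ω b r e) := by
  induction x with
  | zero =>
    simp only [map_zero, zero_mul, LinearMap.zero_apply]
    exact congrArg (Prod.mk 0) (map_zero (relSpace Ω b r).mkQ).symm
  | add x y hx hy =>
    rw [map_add, map_add, LinearMap.add_apply, hx, hy, Prod.mk_add_mk, ← map_add, add_zero]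
    congr 2; ext i; simp [add_mul]
  | tmul x y =>
    simp only [tensorSq, LinearMap.comp_apply, TensorProduct.map_tmul, LinearMap.mul'_apply,
      map_mul, TensorAlgebra.lift_ι_apply, Module.End.mul_apply]
    rw [recAct_apply, recVal_recAct]
    simp

/-- The left `Q(V, Ω)`-module structure on `k ⊕ (B^β / relations)`. -/
noncomputable def recRep : Quad Ω →ₐ[k] Module.End k (k × ((β → Quad Ω) ⧸ relSpace Ω b r)) :=
  RingQuot.liftAlgHom k ⟨TensorAlgebra.lift k (recAct Ω b r), by
    rintro _ _ ⟨x, hx⟩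
    refine LinearMap.ext fun e => ?_
    rw [lift_recAct_tensorSq, map_zero, LinearMap.zero_apply, Submodule.mkQ_apply,
      (Submodule.Quotient.mk_eq_zero _).2 (row_mul_mem_relSpace Ω b r hx _)]
    rfl⟩

theorem recRep_ι (v : V) : recRep Ω b r (Quad.ι Ω v) = recAct Ω b r v := by
  simp [recRep, Quad.ι]

theorem recVal_recRep (a : Quad Ω) (e : k × ((β → Quad Ω) ⧸ relSpace Ω b r)) :
    recVal Ω b r (recRep Ω b r a e) = a * recVal Ω b r e := by
  obtain ⟨a, rfl⟩ := RingQuot.mkAlgHom_surjective k (Rel Ω) a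
  induction a using TensorAlgebra.induction generalizing e with
  | algebraMap c => simp [Algebra.algebraMap_eq_smul_one]
  | ι v =>
    have := recVal_recAct Ω b r v e
    rwa [← recRep_ι] at this
  | mul x y hx hy => rw [map_mul, map_mul, Module.End.mul_apply, hx, hy, mul_assoc]
  | add x y hx hy => rw [map_add, map_add, LinearMap.add_apply, map_add, hx, hy, add_mul]

/-- The complex `Ω ⊗ B → V ⊗ B → B` of a quadratic algebra `B = Q(V, Ω)` is exact. -/
theorem exact_relMat_genMat : Function.Exact (matMap (relMat Ω b r)) (matMap (genMat Ω b)) := by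
  classical
  intro x
  refine ⟨fun hx => ?_, ?_⟩
  · have h : ∑ i, recRep Ω b r (Quad.ι Ω (b i)) (recRep Ω b r (x i) (1, 0)) =
        (0, (relSpace Ω b r).mkQ x) := by
      have : ∀ i, recRep Ω b r (Quad.ι Ω (b i)) (recRep Ω b r (x i) (1, 0)) =
          LinearMap.inr k k _ ((relSpace Ω b r).mkQ (Pi.single i (x i))) := fun i => by
        have h1 : recVal Ω b r (1, 0) = 1 := by simp [recVal]
        rw [recRep_ι, recAct_apply, recVal_recRep, h1, mul_one, LinearMap.inr_apply]
        congr 2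
        ext j
        by_cases h : i = j
        · subst h; simp
        · simp [Ne.symm h]
      rw [Finset.sum_congr rfl fun i _ => this i, ← map_sum, ← map_sum,
        Finset.univ_sum_single]
      rfl
    have h0 : ∑ i, recRep Ω b r (Quad.ι Ω (b i)) (recRep Ω b r (x i) (1, 0)) = 0 := by
      have hx' : ∑ i, Quad.ι Ω (b i) * x i = 0 := congrFun hx ()
      have := congrArg (fun a => recRep Ω b r a (1, 0)) hx'
      simpa [map_sum, LinearMap.sum_apply] using this
    rw [h0] at h
    obtain ⟨y, hy⟩ := (Submodule.Quotient.mk_eq_zero _).1 (congrArg Prod.snd h).symm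
    exact ⟨y, hy⟩
  · rintro ⟨y, rfl⟩
    exact genMat_relMat Ω b r y

theorem proj_ι_mul (m : ℕ) (v : V) (a : Quad Ω) :
    GradedRing.proj (Quad.grading Ω) (m + 1) (Quad.ι Ω v * a) =
      Quad.ι Ω v * GradedRing.proj (Quad.grading Ω) m a := by
  rw [add_comm m 1, GradedRing.proj_apply, GradedRing.proj_apply,
    DirectSum.coe_decompose_mul_add_of_left_mem _ (Quad.ι_mem Ω v)]

theorem proj_zero_ι_mul (v : V) (a : Quad Ω) :
    GradedRing.proj (Quad.grading Ω) 0 (Quad.ι Ω v * a) = 0 := by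
  rw [GradedRing.proj_apply,
    DirectSum.coe_decompose_mul_of_left_mem_of_not_le _ (Quad.ι_mem Ω v) (by simp)]

theorem proj_of_mem {n : ℕ} {a : Quad Ω} (ha : a ∈ Quad.grading Ω n) :
    GradedRing.proj (Quad.grading Ω) n a = a := by
  rw [GradedRing.proj_apply, DirectSum.decompose_of_mem_same _ ha]

theorem proj_zero_eq (a : Quad Ω) :
    ∃ c : k, GradedRing.proj (Quad.grading Ω) 0 a = algebraMap k _ c := by
  have h : GradedRing.proj (Quad.grading Ω) 0 a ∈ Quad.grading Ω 0 := by
    rw [GradedRing.proj_apply]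
    exact SetLike.coe_mem _
  rw [Quad.grading_zero, Submodule.mem_one] at h
  obtain ⟨c, hc⟩ := h
  exact ⟨c, hc.symm⟩

/-- The quadratic relations of `Q(V, Ω)` are exactly the elements of `Ω`. -/
theorem Quad.mk_tensorSq_eq_zero_iff [FiniteDimensional k V] (x : V ⊗[k] V) :
    RingQuot.mkAlgHom k (Rel Ω) (tensorSq k V x) = 0 ↔ x ∈ Ω := by
  refine ⟨fun hx => ?_, Quad.mk_tensorSq_of_mem Ω⟩
  let b := Module.finBasis k V
  let r := Module.finBasis k Ω
  rw [← Quad.sum_ι_mul_row Ω b] at hx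
  obtain ⟨y, hy⟩ := (exact_relMat_genMat Ω b r (fun i => Quad.ι Ω (row b i x))).1
    (funext fun _ => hx)
  choose c hc using fun j => proj_zero_eq Ω (y j)
  have h : ∀ i, row b i x = row b i (∑ j, c j • (r j : V ⊗[k] V)) := fun i => by
    apply Quad.ι_injective Ω
    rw [← proj_of_mem Ω (Quad.ι_mem Ω (row b i x)), ← congrFun hy i, matMap_apply, map_sum]
    simp only [relMat]
    rw [map_sum, map_sum]
    refine Finset.sum_congr rfl fun j _ => ?_
    rw [proj_ι_mul Ω 0, hc, map_smul, map_smul, Algebra.smul_def, Algebra.commutes]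
  rw [← sum_tmul_row b x, Finset.sum_congr rfl fun i _ => by rw [h i], sum_tmul_row]
  exact Ω.sum_mem fun j _ => Ω.smul_mem _ (r j).2

end QuadraticComplex

end QuadAlg

/-! ### Quadratic algebras with a linear resolution of length two -/

namespace QuadAlg

section GlobalDimensionTwo

variable {k : Type u} [Field k] {V : Type w} [AddCommGroup V] [Module k V]
  (Ω : Submodule k (V ⊗[k] V))

theorem Quad.eq_zero_of_proj {a : Quad Ω}
    (h : ∀ n, GradedRing.proj (Quad.grading Ω) n a = 0) : a = 0 := by
  refine (DirectSum.decompose (Quad.grading Ω)).injective ?_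
  rw [DirectSum.decompose_zero]
  exact DFinsupp.ext fun n => Subtype.ext (h n)

theorem proj_mem_grading (n : ℕ) (a : Quad Ω) :
    GradedRing.proj (Quad.grading Ω) n a ∈ Quad.grading Ω n := by
  rw [GradedRing.proj_apply]
  exact SetLike.coe_mem _

variable {p q : Type} [Fintype p] [Fintype q] (b : Module.Basis (p ⊕ q) k V)
  {κ : Type} [Fintype κ] (r : Module.Basis κ k Ω)
  (ha : ∀ x ∈ Ω, ∀ u u' : p, b.repr (row b (.inl u) x) (.inl u') = 0)
  (hb : ∀ x ∈ Ω, (∀ u : p, row b (.inl u) x = 0) → x = 0)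

include ha hb in
omit [Fintype p] [Fintype q] in
/-- The relations of `B` are determined by their components in `U ⊗ W`, and this remains true after
extension of scalars from `k` to `B`. -/
theorem eq_zero_of_sum_repr_row (y : κ → Quad Ω)
    (hy : ∀ u w, ∑ j, b.repr (row b (.inl u) (r j)) (.inr w) • y j = 0) : y = 0 := by
  ext j
  -- extension of scalars is avoided by testing against all functionals on `B`
  refine (Module.forall_dual_apply_eq_zero_iff k (y j)).1 fun φ => ?_
  have hx : ∑ j, φ (y j) • r j = 0 := by
    refine Subtype.ext (hb _ (SetLike.coe_mem _) fun u => b.ext_elem fun i => ?_)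
    rcases i with u' | w
    · rw [ha _ (SetLike.coe_mem _)]; simp
    · have := congrArg φ (hy u w)
      simpa [mul_comm] using this
  exact (Fintype.linearIndependent_iff.1 r.linearIndependent) (fun j => φ (y j)) hx j

include ha in
omit [Fintype κ] in
theorem ι_row_inl (u : p) (j : κ) : Quad.ι Ω (row b (.inl u) (r j)) =
    ∑ w, b.repr (row b (.inl u) (r j)) (.inr w) • Quad.ι Ω (b (.inr w)) := by
  rw [← Quad.sum_ι_repr Ω b, Fintype.sum_sum_type]
  simp [ha _ (r j).2]

include ha in
theorem relMat_inl (u : p) (y : κ → Quad Ω) :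
    ∑ j, relMat Ω b r (.inl u) j * y j = ∑ w, Quad.ι Ω (b (.inr w)) *
      ∑ j, b.repr (row b (.inl u) (r j)) (.inr w) • y j := by
  simp only [relMat, ι_row_inl Ω b r ha, Finset.sum_mul, Finset.mul_sum]
  rw [Finset.sum_comm]
  simp

include r ha hb in
/-- The right ideal of `B` generated by `W` is free: if every relation is determined by its
component in `U ⊗ W` and has no component in `U ⊗ U`, then `W ⊗ B → B` is injective.
The proof is by induction on the degree: by exactness, `∑ w, w ⊗ x w` is the image of an element of
`Ω ⊗ B`, and the image of this element in `U ⊗ B` vanishes. The component of the element in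
`U ⊗ W ⊗ B` therefore vanishes by the inductive hypothesis. -/
theorem eq_zero_of_sum_ι_mul_homogeneous (n : ℕ) (x : q → Quad Ω)
    (hx : ∀ w, x w ∈ Quad.grading Ω n) (h : ∑ w, Quad.ι Ω (b (.inr w)) * x w = 0) : x = 0 := by
  induction n generalizing x with
  | zero =>
    obtain ⟨y, hy⟩ := (exact_relMat_genMat Ω b r (Sum.elim 0 x)).1 (funext fun _ => by
      simpa [matMap_apply, genMat] using h)
    ext w
    have := congrFun hy (.inr w)
    rw [Sum.elim_inr] at this
    rw [← proj_of_mem Ω (hx w), ← this, matMap_apply, map_sum]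
    exact Finset.sum_eq_zero fun j _ => proj_zero_ι_mul Ω _ _
  | succ n ih =>
    obtain ⟨y, hy⟩ := (exact_relMat_genMat Ω b r (Sum.elim 0 x)).1 (funext fun _ => by
      simpa [matMap_apply, genMat] using h)
    have hproj : ∀ i, ∑ j, relMat Ω b r i j * GradedRing.proj (Quad.grading Ω) n (y j) =
        GradedRing.proj (Quad.grading Ω) (n + 1) (Sum.elim 0 x i) := fun i => by
      rw [← congrFun hy i, matMap_apply, map_sum]
      exact Finset.sum_congr rfl fun j _ => (proj_ι_mul Ω n _ _).symm
    have hy0 : (fun j => GradedRing.proj (Quad.grading Ω) n (y j)) = 0 := by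
      refine eq_zero_of_sum_repr_row Ω b r ha hb _ fun u w => ?_
      have h1 := hproj (.inl u)
      rw [relMat_inl Ω b r ha, Sum.elim_inl, Pi.zero_apply, map_zero] at h1
      refine congrFun (ih (fun w => ∑ j, b.repr (row b (.inl u) (r j)) (.inr w) •
        GradedRing.proj (Quad.grading Ω) n (y j)) (fun w => ?_) h1) w
      exact Submodule.sum_mem _ fun j _ => Submodule.smul_mem _ _ (proj_mem_grading Ω n _)
    ext w
    have h2 := hproj (.inr w)
    rw [Sum.elim_inr, proj_of_mem Ω (hx w)] at h2
    rw [← h2, Pi.zero_apply]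
    exact Finset.sum_eq_zero fun j _ => by rw [show GradedRing.proj _ n (y j) = 0 from
      congrFun hy0 j, mul_zero]

include ha hb in
theorem relMat_injective : Function.Injective (matMap (relMat Ω b r)) := by
  refine (injective_iff_map_eq_zero _).2 fun y hy => ?_
  refine eq_zero_of_sum_repr_row Ω b r ha hb y fun u w => Quad.eq_zero_of_proj Ω fun n => ?_
  have h1 := congrFun hy (.inl u)
  rw [matMap_apply, relMat_inl Ω b r ha, Pi.zero_apply] at h1
  have h2 := congrArg (GradedRing.proj (Quad.grading Ω) (n + 1)) h1
  rw [map_sum, map_zero, Finset.sum_congr rfl fun w _ => proj_ι_mul Ω n _ _] at h2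
  exact congrFun (eq_zero_of_sum_ι_mul_homogeneous Ω b r ha hb n _
    (fun w => proj_mem_grading Ω n _) h2) w

end GlobalDimensionTwo

section LengthTwo

variable {k : Type u} [Field k] {V : Type w} [AddCommGroup V] [Module k V]
  (Ω : Submodule k (V ⊗[k] V)) {β κ : Type} [Fintype β] [Fintype κ]
  (b : Module.Basis β k V) (r : Module.Basis κ k Ω)

omit [Fintype β] in
theorem span_genMat (i : Unit) :
    Submodule.span k (Set.range (genMat Ω b i)) = Quad.grading Ω 1 := by
  have : Set.range (genMat Ω b i) = Quad.ι Ω '' Set.range b := by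
    rw [← Set.range_comp]; rfl
  rw [this, ← Submodule.map_span, b.span_eq, Submodule.map_top]
  simp [Quad.grading]

/-- The index sets of the bases of the free modules in a resolution of length two. -/
def lengthTwoIndex (β κ : Type) : ℕ → Type
  | 0 => Unit
  | 1 => β
  | 2 => κ
  | _ + 3 => Empty

instance : Unique (lengthTwoIndex β κ 0) := inferInstanceAs (Unique Unit)

instance : ∀ n, Fintype (lengthTwoIndex β κ n)
  | 0 => inferInstanceAs (Fintype Unit)
  | 1 => inferInstanceAs (Fintype β)
  | 2 => inferInstanceAs (Fintype κ)
  | _ + 3 => inferInstanceAs (Fintype Empty)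

/-- The matrices in the resolution `0 → Ω ⊗ B → V ⊗ B → B`. -/
noncomputable def lengthTwoMat :
    ∀ n, lengthTwoIndex β κ n → lengthTwoIndex β κ (n + 1) → Quad Ω
  | 0 => genMat Ω b
  | 1 => relMat Ω b r
  | _ + 2 => fun _ j => j.elim

/-- A quadratic algebra `B = Q(V, Ω)` with `Ω ⊗ B → V ⊗ B` injective is Koszul. -/
theorem isKoszul_of_relMat_injective (hinj : Function.Injective (matMap (relMat Ω b r))) :
    IsKoszul (Quad.grading Ω) := by
  refine isKoszul_of_matrices _ (Quad.grading_zero Ω) (Quad.grading_eq_pow Ω)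
    (lengthTwoIndex β κ) (lengthTwoMat Ω b r) ?_ (span_genMat Ω b ()) ?_
  · rintro (_ | _ | n) i j
    · exact Quad.ι_mem Ω _
    · exact Quad.ι_mem Ω _
    · exact j.elim
  · rintro (_ | _ | n) x
    · exact exact_relMat_genMat Ω b r x
    · have hz : ∀ y : Empty → Quad Ω,
          matMap (fun (_ : κ) (j : Empty) => (j.elim : Quad Ω)) y = 0 := fun y => by
        ext i
        simp [matMap_apply]
      have hx : ∀ x : κ → Quad Ω, matMap (relMat Ω b r) x = 0 ↔ ∃ y : Empty → Quad Ω,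
          matMap (fun (_ : κ) (j : Empty) => (j.elim : Quad Ω)) y = x := fun x => by
        simp only [hz]
        exact ⟨fun h => ⟨0, (hinj (h.trans (map_zero _).symm)).symm⟩,
          fun ⟨_, h⟩ => h ▸ map_zero _⟩
      exact hx x
    · have h0 : x = 0 := funext fun j => (j : Empty).elim
      subst h0
      constructor
      · exact fun _ => ⟨0, map_zero _⟩
      · exact fun _ => map_zero _

theorem exact_genMat_augMap :
    Function.Exact (matMap (genMat Ω b)) (augMap (Quad.grading Ω) Unit) :=
  exact_augMap _ (Quad.grading_eq_pow Ω) _ (span_genMat Ω b _)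

open CategoryTheory CategoryTheory.Abelian in
theorem cd_le_two (hinj : Function.Injective (matMap (relMat Ω b r))) :
    cd (Quad.grading Ω) ≤ 2 := by
  have := hasProjectiveDimensionLT_three (augMap (Quad.grading Ω) Unit) (matMap (genMat Ω b))
    (matMap (relMat Ω b r)) (augMap_surjective _ _) (exact_genMat_augMap Ω b)
    (exact_relMat_genMat Ω b r) hinj
  refine iSup₂_le fun n hn => ?_
  by_contra hlt
  have h3 : 3 ≤ n := by
    have : ¬ n ≤ 2 := fun h => hlt (by exact_mod_cast h)
    omega
  have hs := HasProjectiveDimensionLT.subsingleton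
    (ModuleCat.of (Quad Ω)ᵐᵒᵖ (Triv (Quad.grading Ω))) 3 n h3
    (ModuleCat.of (Quad Ω)ᵐᵒᵖ (Triv (Quad.grading Ω)))
  exact not_subsingleton_iff_nontrivial.2 hn hs

/-- The elements of `V` annihilate the trivial module. -/
theorem op_ι_smul_triv (v : V) (t : Triv (Quad.grading Ω)) :
    MulOpposite.op (Quad.ι Ω v) • t = 0 := by
  obtain ⟨a, rfl⟩ := Submodule.Quotient.mk_surjective _ t
  rw [← Submodule.Quotient.mk_smul, Submodule.Quotient.mk_eq_zero, op_smul_eq_mul]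
  induction a using DirectSum.Decomposition.inductionOn (Quad.grading Ω) with
  | zero => simp
  | @homogeneous m a =>
    exact Submodule.subset_span ⟨m + 1, m.succ_pos,
      SetLike.mul_mem_graded a.2 (Quad.ι_mem Ω v)⟩
  | add x y hx hy => rw [add_mul]; exact add_mem hx hy

theorem one_notMem_augIdeal : (1 : Quad Ω) ∉ augIdeal (Quad.grading Ω) := by
  intro h
  have key : ∀ a ∈ augIdeal (Quad.grading Ω),
      GradedRing.projZeroRingHom (Quad.grading Ω) a = 0 := fun a ha => by
    induction ha using Submodule.span_induction with
    | mem a ha =>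
      obtain ⟨n, hn, ha⟩ := ha
      exact DirectSum.decompose_of_mem_ne _ ha hn.ne'
    | zero => exact map_zero _
    | add x y _ _ hx hy => rw [map_add, hx, hy, add_zero]
    | smul c x _ hx =>
      rw [show c • x = x * c.unop from rfl, map_mul, hx, zero_mul]
  exact one_ne_zero ((map_one _).symm.trans (key 1 h))

open CategoryTheory CategoryTheory.Abelian in
/-- If there are relations, then `Ext²(k, k) ≠ 0`: the maps in the resolution have coefficients
in the augmentation ideal, hence vanish after applying `Hom(-, k)`. -/
theorem two_le_cd [Nonempty κ] (hinj : Function.Injective (matMap (relMat Ω b r))) :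
    2 ≤ cd (Quad.grading Ω) := by
  classical
  refine le_iSup₂_of_le 2 ?_ le_rfl
  refine not_subsingleton_iff_nontrivial.1 fun hs => ?_
  obtain ⟨j⟩ := ‹Nonempty κ›
  obtain ⟨ψ, hψ⟩ := exists_extension_of_subsingleton_ext_two (augMap (Quad.grading Ω) Unit)
    (matMap (genMat Ω b)) (matMap (relMat Ω b r)) (augMap_surjective _ _)
    (exact_genMat_augMap Ω b) (exact_relMat_genMat Ω b r) hinj hs
    ((augIdeal (Quad.grading Ω)).mkQ ∘ₗ LinearMap.proj j)
  have h1 := LinearMap.congr_fun hψ (Pi.single j 1)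
  have h2 : matMap (relMat Ω b r) (Pi.single j 1) =
      ∑ i, MulOpposite.op (relMat Ω b r i j) • rightBasis (Quad Ω) β i := by
    ext i
    simp [matMap_apply, rightBasis_apply, Pi.single_apply]
  rw [LinearMap.comp_apply, h2, map_sum, Finset.sum_eq_zero] at h1
  · refine one_notMem_augIdeal Ω ((Submodule.Quotient.mk_eq_zero _).1 ?_)
    simpa using h1.symm
  · intro i _
    rw [map_smul]
    exact op_ι_smul_triv Ω _ _

end LengthTwo

end QuadAlg

/-! ### Orthogonal relations -/

namespace QuadAlg

section Dual

variable {k : Type u} [Field k] {V : Type w} [AddCommGroup V] [Module k V]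
  [FiniteDimensional k V] (Ω : Submodule k (V ⊗[k] V))

theorem exists_basis_relations :
    ∃ (n : ℕ) (_ : Module.Basis (Fin n) k Ω), Ω ≠ ⊥ → Nonempty (Fin n) :=
  ⟨_, Module.finBasis k Ω, fun h => Fin.pos_iff_nonempty.1
    (Nat.pos_of_ne_zero fun h0 => h (Submodule.finrank_eq_zero.1 h0))⟩

omit [FiniteDimensional k V] in
theorem row_dualBasis_apply {β : Type} [Finite β] [DecidableEq β] (b : Module.Basis β k V) (i : β)
    (θ : Module.Dual k V ⊗[k] Module.Dual k V) (y : V) :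
    row b.dualBasis i θ y = TensorProduct.dualDistrib k V V θ (b i ⊗ₜ y) := by
  induction θ with
  | zero => simp
  | add θ η hθ hη => simp only [map_add, LinearMap.add_apply, hθ, hη]
  | tmul α β => simp

theorem dualDistrib_injective : Function.Injective (TensorProduct.dualDistrib k V V) :=
  (TensorProduct.dualDistribEquiv k V V).injective

theorem orth_ne_bot (h : Quad.grading Ω 2 ≠ ⊥) : orth Ω ≠ ⊥ := by
  contrapose! h
  have h1 : Ω.dualAnnihilator = ⊥ := by
    rw [eq_bot_iff]
    intro f hf
    obtain ⟨θ, hθ⟩ := (TensorProduct.dualDistribEquiv k V V).surjective f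
    have hθ' : TensorProduct.dualDistrib k V V θ = f := hθ
    have : θ ∈ orth Ω := by rwa [orth, Submodule.mem_comap, hθ']
    rw [h, Submodule.mem_bot] at this
    rw [← hθ', this, map_zero]
    exact zero_mem _
  have h2 : Ω = ⊤ := Submodule.dualAnnihilator_eq_bot_iff.1 h1
  rw [eq_bot_iff, Quad.grading_eq_pow, pow_two, Submodule.mul_le]
  intro x hx y hy
  simp only [Quad.grading, pow_one] at hx hy
  obtain ⟨v, rfl⟩ := hx
  obtain ⟨w, rfl⟩ := hy
  have := Quad.mk_tensorSq_of_mem Ω (x := v ⊗ₜ w) (h2 ▸ trivial)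
  simpa [tensorSq, Quad.ι] using this

omit [FiniteDimensional k V] in
/-- A decomposition of `Q(V, Ω)₁` lifts to a decomposition of `V`. -/
theorem isCompl_comap_ι {U W : Submodule k (Quad Ω)} (hsup : U ⊔ W = Quad.grading Ω 1)
    (hinf : U ⊓ W = ⊥) : IsCompl (U.comap (Quad.ι Ω)) (W.comap (Quad.ι Ω)) := by
  have hr : Quad.grading Ω 1 = LinearMap.range (Quad.ι Ω) := pow_one _
  constructor
  · rw [disjoint_iff, ← Submodule.comap_inf, hinf, Submodule.comap_bot,
      LinearMap.ker_eq_bot.2 (Quad.ι_injective Ω)]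
  · rw [codisjoint_iff]
    apply Submodule.map_injective_of_injective (Quad.ι_injective Ω)
    rw [Submodule.map_sup, Submodule.map_comap_eq, Submodule.map_comap_eq, Submodule.map_top,
      inf_eq_right.2 (hr ▸ hsup ▸ le_sup_left), inf_eq_right.2 (hr ▸ hsup ▸ le_sup_right), hsup, hr]

theorem tmul_mem_of_mul_eq_bot {U : Submodule k (Quad Ω)} (hUU : U * U = ⊥) {x y : V}
    (hx : Quad.ι Ω x ∈ U) (hy : Quad.ι Ω y ∈ U) : x ⊗ₜ y ∈ Ω := by
  rw [← Quad.mk_tensorSq_eq_zero_iff]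
  have h : Quad.ι Ω x * Quad.ι Ω y ∈ U * U := Submodule.mul_mem_mul hx hy
  rw [hUU, Submodule.mem_bot] at h
  simpa [tensorSq, Quad.ι] using h

/-- A functional on `V ⊗ V` which vanishes on `Ω` and on `U ⊗ W` vanishes, if `UW = Q(V, Ω)₂`. -/
theorem eq_zero_of_forall_tmul {U W : Submodule k (Quad Ω)} (hU : U ≤ Quad.grading Ω 1)
    (hW : W ≤ Quad.grading Ω 1) (hUW : U * W = Quad.grading Ω 2) {f : Module.Dual k (V ⊗[k] V)}
    (hf : f ∈ Ω.dualAnnihilator)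
    (h : ∀ x y, Quad.ι Ω x ∈ U → Quad.ι Ω y ∈ W → f (x ⊗ₜ y) = 0) : f = 0 := by
  have key : ∀ a ∈ U * W, ∃ z, RingQuot.mkAlgHom k (Rel Ω) (tensorSq k V z) = a ∧ f z = 0 := by
    intro a ha
    induction ha using Submodule.mul_induction_on' with
    | mem_mul_mem a ha c hc =>
      have ha' := hU ha
      have hc' := hW hc
      simp only [Quad.grading, pow_one] at ha' hc'
      obtain ⟨x, rfl⟩ := ha'
      obtain ⟨y, rfl⟩ := hc'
      exact ⟨x ⊗ₜ y, by simp [tensorSq, Quad.ι], h x y ha hc⟩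
    | add a _ c _ ha hc =>
      obtain ⟨z, hz, hz'⟩ := ha
      obtain ⟨t, ht, ht'⟩ := hc
      exact ⟨z + t, by rw [map_add, map_add, hz, ht], by rw [map_add, hz', ht', add_zero]⟩
  refine LinearMap.ext fun z => ?_
  obtain ⟨y, hy, -⟩ := Quad.lift_tensorSq Ω z
  obtain ⟨t, ht, ht'⟩ := key (RingQuot.mkAlgHom k (Rel Ω) (tensorSq k V z))
    (by rw [hUW, ← hy]; exact y.2)
  have hzt : z - t ∈ Ω := by
    rw [← Quad.mk_tensorSq_eq_zero_iff, map_sub, map_sub, ht, sub_self]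
  have := (Submodule.mem_dualAnnihilator f).1 hf _ hzt
  rw [map_sub, ht', sub_zero] at this
  rw [this, LinearMap.zero_apply]

/-- If `A = Q(V, Ω)` satisfies `A₁ = U ⊕ W`, `UW = A₂` and `UU = 0`, then
`Ω^⊥ ⊗ A^! → V^* ⊗ A^!` is injective. The basis of `V^*` is dual to a basis of `V` adapted to
`U ⊕ W`. -/
theorem exists_basis_relMat_orth_injective {U W : Submodule k (Quad Ω)}
    (hsup : U ⊔ W = Quad.grading Ω 1) (hinf : U ⊓ W = ⊥) (hUW : U * W = Quad.grading Ω 2)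
    (hUU : U * U = ⊥) {κ : Type} [Fintype κ] (r : Module.Basis κ k (orth Ω)) :
    ∃ (p q : ℕ) (b : Module.Basis (Fin p ⊕ Fin q) k (Module.Dual k V)),
      Function.Injective (matMap (relMat (orth Ω) b r)) := by
  have hc := isCompl_comap_ι Ω hsup hinf
  let bU := Module.finBasis k (U.comap (Quad.ι Ω))
  let bW := Module.finBasis k (W.comap (Quad.ι Ω))
  let b := (bU.prod bW).map (Submodule.prodEquivOfIsCompl _ _ hc)
  have hbU : ∀ i, b (.inl i) = bU i := fun i => by simp [b]
  have hmem : ∀ i, Quad.ι Ω (b (.inl i)) ∈ U := fun i => by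
    rw [hbU]; exact (bU i).2
  refine ⟨_, _, b.dualBasis, relMat_injective (orth Ω) b.dualBasis r ?_ ?_⟩
  · intro θ hθ u u'
    rw [Module.Basis.dualBasis_repr, row_dualBasis_apply]
    exact (Submodule.mem_dualAnnihilator _).1 hθ _ (tmul_mem_of_mul_eq_bot Ω hUU (hmem u) (hmem u'))
  · intro θ hθ h
    apply dualDistrib_injective
    rw [map_zero]
    refine eq_zero_of_forall_tmul Ω (hsup ▸ le_sup_left) (hsup ▸ le_sup_right) hUW hθ
      fun x y hx _ => ?_
    have hz : (TensorProduct.dualDistrib k V V θ) ∘ₗ (TensorProduct.mk k V V).flip y ∘ₗ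
        (U.comap (Quad.ι Ω)).subtype = 0 := bU.ext fun i => by
      have := row_dualBasis_apply b (.inl i) θ y
      rw [h i, LinearMap.zero_apply, hbU] at this
      simpa using this.symm
    exact LinearMap.congr_fun hz ⟨x, hx⟩

end Dual

section Cubic

variable {k : Type u} [Field k] {A : Type v} [Ring A] [Algebra k A] (𝒜 : ℕ → Submodule k A)

theorem eq_bot_of_three_le (hgen : ∀ n, 𝒜 n = 𝒜 1 ^ n) {U W : Submodule k A}
    (hW : W ≤ 𝒜 1) (hUW : U * W = 𝒜 2) (hUU : U * U = ⊥) (n : ℕ) (hn : 3 ≤ n) : 𝒜 n = ⊥ := by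
  have h2 : 𝒜 2 * 𝒜 1 = ⊥ := by
    rw [eq_bot_iff]
    calc 𝒜 2 * 𝒜 1 = U * (W * 𝒜 1) := by rw [← hUW, mul_assoc]
      _ ≤ U * 𝒜 2 := mul_le_mul_right (by
          rw [hgen 2, pow_two]; exact mul_le_mul_left hW _) _
      _ = ⊥ := by rw [← hUW, ← mul_assoc, hUU, Submodule.bot_mul]
  obtain ⟨m, rfl⟩ := Nat.exists_eq_add_of_le hn
  rw [hgen, pow_add, show 3 = 2 + 1 from rfl, pow_succ, ← hgen 2, h2, Submodule.bot_mul]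

end Cubic

end QuadAlg

open QuadAlg in
theorem theorem1p5 {k : Type u} [Field k] {A : Type v} [Ring A] [Algebra k A]
    (𝒜 : ℕ → Submodule k A) [GradedAlgebra 𝒜]
    {V : Type w} [AddCommGroup V] [Module k V] [FiniteDimensional k V]
    (Ω : Submodule k (V ⊗[k] V))
    (e : A ≃ₐ[k] Quad Ω) (he : ∀ n, (𝒜 n).map e.toLinearMap = Quad.grading Ω n)
    (U W : Submodule k A) (hsup : U ⊔ W = 𝒜 1) (hinf : U ⊓ W = ⊥)
    (hUW : U * W = 𝒜 2) (hUU : U * U = ⊥) :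
    IsKoszul 𝒜 ∧ IsKoszul (Quad.grading (orth Ω)) ∧ 𝒜 3 = ⊥ ∧
      cd (Quad.grading (orth Ω)) ≤ 2 ∧
      (𝒜 2 ≠ ⊥ → cd (Quad.grading (orth Ω)) = 2) := by
  have he' : ∀ n, (𝒜 n).map e.toAlgHom.toLinearMap = Quad.grading Ω n := he
  have hinj : Function.Injective (Submodule.map e.toAlgHom.toLinearMap) :=
    Submodule.map_injective_of_injective e.injective
  have h0 : 𝒜 0 = 1 := hinj (by rw [he', Quad.grading_zero, Submodule.map_one])
  have hgen : ∀ n, 𝒜 n = 𝒜 1 ^ n := fun n => hinj (by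
    rw [he', Quad.grading_eq_pow, Submodule.map_pow, he'])
  have hU : U ≤ 𝒜 1 := hsup ▸ le_sup_left
  have hW : W ≤ 𝒜 1 := hsup ▸ le_sup_right
  have hbig := eq_bot_of_three_le 𝒜 hgen hW hUW hUU
  have hfin : FiniteDimensional k (𝒜 1) := by
    have h1 : Module.Finite k (LinearMap.range (Quad.ι Ω)) := inferInstance
    rw [← pow_one (LinearMap.range (Quad.ι Ω)), ← Quad.grading, ← he' 1] at h1
    exact Module.Finite.equiv
      (Submodule.equivMapOfInjective e.toAlgHom.toLinearMap e.injective (𝒜 1)).symm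
  obtain ⟨n, r, hr⟩ := exists_basis_relations (orth Ω)
  obtain ⟨p, q, b, hb⟩ := exists_basis_relMat_orth_injective Ω
    (U := U.map e.toAlgHom.toLinearMap) (W := W.map e.toAlgHom.toLinearMap)
    (by rw [← Submodule.map_sup, hsup, he'])
    (by rw [← Submodule.map_inf _ e.injective, hinf, Submodule.map_bot])
    (by rw [← Submodule.map_mul, hUW, he'])
    (by rw [← Submodule.map_mul, hUU, Submodule.map_bot])
    r
  have hcd := cd_le_two (orth Ω) b _ hb
  refine ⟨isKoszul_of_mul_eq 𝒜 h0 hgen hbig hU hW hUW hUU,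
    isKoszul_of_relMat_injective (orth Ω) b _ hb, hbig 3 le_rfl, hcd, fun h2 => ?_⟩
  have hne : orth Ω ≠ ⊥ := orth_ne_bot Ω fun h => h2 (hinj (by rw [he', h, Submodule.map_bot]))
  have := hr hne
  exact le_antisymm hcd (two_le_cd (orth Ω) b _ hb)
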